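/- **Setting.** For every $n$ let $(X^{(n)},Y^{(n)})$ be a random vector in $\mathbb R^{p_n}\times\{0,1\}$ (the index $n$ is mostly dropped), and let $(X_i,Y_i)$, $i=1,\dots,n$, be an i.i.d. sample from its law. Assume that the coordinates of $X$ are subgaussian, $E e^{tX_{j}}\le e^{t^2\sigma_{jn}^2/2}$ for all $t\in\mathbb R$, with $\limsup_n\max_j\sigma_{jn}^2<\infty$. Assume the semiparametric binary model $P(Y=1\mid X)=q_n(\beta^TX)$ with true parameter $\beta=\beta_n\in\mathbb R^{p_n}$ and unknown $q_n$, and the linear regressions condition $E(X\mid\beta^TX)=u_0+u\,\beta^TX$ for some vectors $u_0=u_{0,n}$ and $u=u_n$ in $\mathbb R^{p_n}$. Let $\rho:\mathbb R\times\{0,1\}\to\mathbb R$ be convex and Lipschitz in its first argument, $R(b)=E\rho(b^TX,Y)$ and $R_n(b)=\frac1n\sum_{i=1}^n\rho(b^TX_i,Y_i)$. Assume that $R$ has a unique minimizer $\beta^*=\beta^*_n$ over $\mathbb R^{p_n}$. Put $s=\operatorname{supp}\beta$, $s^*=\operatorname{supp}\beta^*$ and $\beta^*_{\min}=\min_{i\in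 s^*}|\beta_i^*|$ ($=+\infty$ if $s^*=\emptyset$). For $\varepsilon>0$ let $\mathcal C_\varepsilon=\{\Delta\in\mathbb R^{p_n}:\|\Delta_{s^{*c}}\|_1\le(3+\varepsilon)\|\Delta_{s^*}\|_1\}$ and, for a nonnegative definite matrix $H$, $\kappa_H(\varepsilon)=\inf_{\Delta\in\mathcal C_\varepsilon\setminus\{0\}}\Delta^TH\Delta/\Delta^T\Delta$ ($=+\infty$ if $\mathcal C_\varepsilon=\{0\}$). **SS procedure** with parameters $\lambda=\lambda_n>0$ and $a_n>0$. Let $\hat\beta_L$ be a minimizer of $R_n(b)+\lambda\|b\|_1$ over $b\in\mathbb R^{p_n}$; order its support as $j_1,\dots,j_k$ with $|\hat\beta_{L,j_1}|\ge\dots\ge|\hat\beta_{L,j_k}|>0$; put $\mathcal M_{SS}=\{\emptyset,\{j_1\},\dots,\{j_1,\dots,j_k\}\}$; let $\hat s^*$ be a minimizer over $w\in\mathcal M_{SS}$ of $GIC(w)=\inf_{\operatorname{supp}b\subseteq w}nR_n(b)+a_n|w|$. Ties may be broken in any way. **Assumptions.** Let $k_n\ge1$ be integers, and let $\vartheta,\delta,\varepsilon_1,\theta,\varepsilon_2,\varepsilon_3>0$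 be constants not depending on $n$, and $H=H_n$ nonnegative definite $p_n\times p_n$ matrices, such that for every $n$: * $R(b)-R(\beta^*)\ge\frac\vartheta2(b-\beta^*)^TH(b-\beta^*)$ whenever $b-\beta^*\in\mathcal C_{\varepsilon_1}$ and $\|b-\beta^*\|_1\le\delta$; * for every $w\subseteq\{1,\dots,p_n\}$ with $|w|\le k_n$: $R(b)-R(\beta^*)\ge\theta\|b-\beta^*\|_2^2$ whenever $\operatorname{supp}b\subseteq w$ and $\|b-\beta^*\|_2\le\varepsilon_2$; * $|s^*|\le k_n$; and, as $n\to\infty$: $P(|w|\le k_n\text{ for all }w\in\mathcal M_{SS})\to1$; $\liminf_n\kappa_{H}(\varepsilon_3)>0$; $\log(p_n\vee2)=o(n\lambda^2)$; $k_n\lambda=o(\min\{\beta^*_{\min},1\})$; $k_n\log(p_n\vee2)=o(n)$; $k_n\log(p_n\vee2)=o(a_n)$; $a_nk_n=o(n\min\{\beta^*_{\min},1\}^2)$. **Conclusion.** 1. For every $n$ there is $\eta=\eta_n\in\mathbb R$ with $\beta^*=\eta\beta$. Moreover $\eta\ne0$ if $\operatorname{Cov}(Y,X)\neq0$ and $\rho(\cdot,0)$,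 $\rho(\cdot,1)$ are differentiable at $0$ with different derivatives there. 2. Suppose that, for all large $n$ with $\beta\ne0$, either $\beta^*\ne0$ (that is, $\eta\neq0$) or the sufficient condition for $\eta\ne0$ in part 1 holds. Then $P(\hat s^*=s)\to1$. -/

import Mathlib

open MeasureTheory ProbabilityTheory Filter Topology Asymptotics
open scoped NNReal ENNReal

noncomputable section

/-- One observation `(x, y)`: a vector of `p` predictors and a binary response in `{0, 1}`. -/
abbrev Obs (p : ℕ) : Type := (Fin p → ℝ) × Fin 2

/-- The support `{i : b i ≠ 0}` of a vector. -/
def supp {p : ℕ} (b : Fin p → ℝ) : Finset (Fin p) :=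
  Finset.univ.filter fun i => b i ≠ 0

/-- The `ℓ¹` norm. -/
def l1norm {p : ℕ} (b : Fin p → ℝ) : ℝ := ∑ i, |b i|

/-- The Euclidean norm. -/
def l2norm {p : ℕ} (b : Fin p → ℝ) : ℝ := √(∑ i, b i ^ 2)

/-- The risk `R(b) = E ρ(bᵀX, Y)`, where `μ` is the law of `(X, Y)`. -/
def risk {p : ℕ} (ρ : ℝ → Fin 2 → ℝ) (μ : Measure (Obs p)) (b : Fin p → ℝ) : ℝ :=
  ∫ z, ρ (b ⬝ᵥ z.1) z.2 ∂μ

/-- `b₀` is the unique minimizer of the risk over all of `ℝᵖ`. -/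
def IsPseudoTrue {p : ℕ} (ρ : ℝ → Fin 2 → ℝ) (μ : Measure (Obs p)) (b₀ : Fin p → ℝ) : Prop :=
  ∀ b, b ≠ b₀ → risk ρ μ b₀ < risk ρ μ b

/-- The empirical risk `Rₙ(b) = n⁻¹ ∑ᵢ ρ(bᵀXᵢ, Yᵢ)` of a sample of size `n`. -/
def empRisk {p n : ℕ} (ρ : ℝ → Fin 2 → ℝ) (z : Fin n → Obs p) (b : Fin p → ℝ) : ℝ :=
  (n : ℝ)⁻¹ * ∑ i, ρ (b ⬝ᵥ (z i).1) (z i).2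

/-- `min_{i ∈ supp b} |b i|`, as an extended real: it is `+∞` if `b = 0`. -/
def coefMin {p : ℕ} (b : Fin p → ℝ) : EReal :=
  ⨅ i ∈ supp b, ((|b i| : ℝ) : EReal)

/-- The (always finite) number `min {min_{i ∈ supp b} |b i|, 1}`. -/
def cappedMin {p : ℕ} (b : Fin p → ℝ) : ℝ := (min (coefMin b) 1).toReal

/-- The cone of all `Δ` with `‖Δ_{sᶜ}‖₁ ≤ (3 + ε) ‖Δ_s‖₁`. -/
def cone {p : ℕ} (s : Finset (Fin p)) (ε : ℝ) : Set (Fin p → ℝ) :=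
  {Δ | ∑ i ∈ sᶜ, |Δ i| ≤ (3 + ε) * ∑ i ∈ s, |Δ i|}

/-- The infimum of `ΔᵀHΔ / ΔᵀΔ` over the nonzero vectors of the cone, as an extended real:
it is `+∞` if the cone is trivial. -/
def kappa {p : ℕ} (H : Matrix (Fin p) (Fin p) ℝ) (s : Finset (Fin p)) (ε : ℝ) : EReal :=
  ⨅ Δ ∈ cone s ε \ {0}, (((Δ ⬝ᵥ H.mulVec Δ) / (Δ ⬝ᵥ Δ) : ℝ) : EReal)

/-- The margin condition on the intersection of the cone and an `ℓ¹` ball around `b₀`. -/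
def MarginCondition {p : ℕ} (ρ : ℝ → Fin 2 → ℝ) (μ : Measure (Obs p)) (b₀ : Fin p → ℝ)
    (H : Matrix (Fin p) (Fin p) ℝ) (ϑ ε δ : ℝ) : Prop :=
  ∀ b, b - b₀ ∈ cone (supp b₀) ε → l1norm (b - b₀) ≤ δ →
    ϑ / 2 * ((b - b₀) ⬝ᵥ H.mulVec (b - b₀)) ≤ risk ρ μ b - risk ρ μ b₀

/-- The quadratic margin condition for vectors supported in `w`, in a Euclidean ball around `b₀`. -/
def ModelMarginCondition {p : ℕ} (ρ : ℝ → Fin 2 → ℝ) (μ : Measure (Obs p)) (b₀ : Fin p → ℝ)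
    (θ ε : ℝ) (w : Finset (Fin p)) : Prop :=
  ∀ b, supp b ⊆ w → l2norm (b - b₀) ≤ ε →
    θ * l2norm (b - b₀) ^ 2 ≤ risk ρ μ b - risk ρ μ b₀

/-- The generalized information criterion `min_{supp b ⊆ w} n Rₙ(b) + a |w|`. The minimum is
written as an infimum in the extended reals, so that the criterion also makes sense for samples on
which the minimum is not attained (as for logistic loss and separated data). -/
def gic {p n : ℕ} (ρ : ℝ → Fin 2 → ℝ) (a : ℝ) (z : Fin n → Obs p) (w : Finset (Fin p)) : EReal :=
  (⨅ b ∈ {b : Fin p → ℝ | supp b ⊆ w}, (((n : ℝ) * empRisk ρ z b : ℝ) : EReal)) +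
    ((a * (w.card : ℝ) : ℝ) : EReal)

/-- The nested family `∅, {j₁}, {j₁, j₂}, …, {j₁, …, j_k}` of an ordered list `j₁, …, j_k`. -/
def nestedFamily {p : ℕ} (l : List (Fin p)) : Set (Finset (Fin p)) :=
  {w | ∃ m ≤ l.length, w = (l.take m).toFinset}

/-- `b`, `l`, `s` are the outcome of a run of the screening and selection procedure on the
sample `z`: `b` is a Lasso solution, `l` lists the support of `b` by decreasing absolute value
of the coefficients, and `s` minimizes the criterion over the nested family of `l`.
Ties may be broken in any way. -/
structure IsSSRun {p n : ℕ} (ρ : ℝ → Fin 2 → ℝ) (lam a : ℝ) (z : Fin n → Obs p)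
    (b : Fin p → ℝ) (l : List (Fin p)) (s : Finset (Fin p)) : Prop where
  lasso : ∀ b', empRisk ρ z b + lam * l1norm b ≤ empRisk ρ z b' + lam * l1norm b'
  nodup : l.Nodup
  mem_iff : ∀ j, j ∈ l ↔ j ∈ supp b
  sorted : l.Pairwise fun i j => |b j| ≤ |b i|
  selected_mem : s ∈ nestedFamily l
  selected_min : ∀ w ∈ nestedFamily l, gic ρ a z s ≤ gic ρ a z w

/-- The semiparametric binary model: `P(Y = 1 | X) = q(βᵀX)` almost surely. -/
def IsSemiparametric {p : ℕ} (μ : Measure (Obs p)) (β : Fin p → ℝ) (q : ℝ → ℝ) : Prop :=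
  Measurable q ∧
    μ[({z : Obs p | z.2 = 1}).indicator (fun _ => (1 : ℝ)) |
        MeasurableSpace.comap (fun z : Obs p => z.1) inferInstance]
      =ᵐ[μ] fun z => q (β ⬝ᵥ z.1)

/-- The linear regressions condition: `E(X | βᵀX) = u₀ + u βᵀX` for some vectors `u₀`, `u`. -/
def LinearRegressions {p : ℕ} (μ : Measure (Obs p)) (β : Fin p → ℝ) : Prop :=
  ∃ u₀ u : Fin p → ℝ, ∀ j,
    μ[(fun z : Obs p => z.1 j) |
        MeasurableSpace.comap (fun z : Obs p => β ⬝ᵥ z.1) inferInstance]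
      =ᵐ[μ] fun z => u₀ j + u j * (β ⬝ᵥ z.1)

/-- `Cov(Y, X)`, as a vector. -/
def covYX {p : ℕ} (μ : Measure (Obs p)) : Fin p → ℝ := fun j =>
  covariance (fun z : Obs p => ((z.2 : ℕ) : ℝ)) (fun z : Obs p => z.1 j) μ

/-- The losses of the two responses are differentiable at `0`, with different derivatives. -/
def DistinguishesResponses (ρ : ℝ → Fin 2 → ℝ) : Prop :=
  DifferentiableAt ℝ (fun t => ρ t 0) 0 ∧ DifferentiableAt ℝ (fun t => ρ t 1) 0 ∧
    deriv (fun t => ρ t 0) 0 ≠ deriv (fun t => ρ t 1) 0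

end

/-! ### Comparison of the expected maximum with that of a symmetrized linear process -/

section FiniteMax

variable {ι : Type*} [Fintype ι]

/-! Proportionality is a conditional Jensen argument. Subgaussianity forces `E X = 0`, so the linear
regression of `X` on the index `βᵀX` has no intercept. Given the index, `Y` carries no further
information on `X`, hence `bᵀX` has conditional mean `(b ⬝ᵥ u) βᵀX` given `(βᵀX, Y)`, and replacing
`b` by `(b ⬝ᵥ u) • β` cannot increase the risk (`risk_projection_le`). Uniqueness of the minimizer
makes `β*` a multiple of `β`. If the multiple were zero, the gradient of the risk at `0` would
vanish, which forces `Cov(Y, X) = 0` (`covYX_eq_zero_of_isPseudoTrue_zero`). So eventually `supp β*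
= supp β`, and it suffices to recover `supp β*`.

All randomness in the recovery enters through one bound (`measure_deviationSet_le`): the centered
empirical process exceeds `τ` somewhere on the `ℓ¹` ball of radius `t` around `β*` with probability
`O(t √(log p / n) / τ)`. It follows from Markov's inequality, symmetrization and contraction carried
out one observation at a time, and a maximal inequality for subgaussian sums.

The rest is deterministic, off three such events. Convexity allows every estimate to be made on a
small sphere around `β*`. Off the first event the Lasso has `ℓ¹` error at most a constant times `k
λ` (`lasso_error_le`), which is less than half the smallest nonzero `|β*_i|`; sorting by magnitude
then puts `supp β*` into the nested family. Off the other two the criterion picks it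
(`selected_eq_supp`): a smaller model pays more than `a k` in empirical risk, while a larger one
gains less than the penalty `a` of a single extra variable. -/

lemma iSup_fin_le_iff [Nonempty ι] {v : ι → ℝ} {c : ℝ} : ⨆ i, v i ≤ c ↔ ∀ i, v i ≤ c :=
  ciSup_le_iff (Set.finite_range v).bddAbove

lemma le_iSup_fin (v : ι → ℝ) (i : ι) : v i ≤ ⨆ i, v i :=
  le_ciSup (Set.finite_range v).bddAbove i

lemma abs_iSup_fin_le [Nonempty ι] (v : ι → ℝ) : |⨆ i, v i| ≤ ∑ i, |v i| := by
  have h1 : ∀ i, |v i| ≤ ∑ i, |v i| := fun i =>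
    Finset.single_le_sum (f := fun i => |v i|) (fun _ _ => abs_nonneg _) (Finset.mem_univ i)
  let i₀ : ι := Classical.arbitrary ι
  rw [abs_le]
  constructor
  · exact (neg_le_neg (h1 i₀)).trans ((neg_abs_le _).trans (le_iSup_fin v i₀))
  · exact iSup_fin_le_iff.2 fun i => (le_abs_self _).trans (h1 i)

lemma integrable_iSup_fin [Nonempty ι] {α : Type*} [MeasurableSpace α] {μ : Measure α}
    {f : α → ι → ℝ} (hf : ∀ i, Integrable (fun x => f x i) μ) :
    Integrable (fun x => ⨆ i, f x i) μ := by
  refine Integrable.mono' (integrable_finsetSum Finset.univ fun i _ => (hf i).abs)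
    (AEMeasurable.iSup fun i => (hf i).aemeasurable).aestronglyMeasurable ?_
  exact ae_of_all _ fun x => by simpa using abs_iSup_fin_le (f x)

/-- Symmetrization and contraction for one observation. -/
lemma integral_iSup_centered_le [Nonempty ι] {α : Type*} [MeasurableSpace α]
    {μ : Measure α} [IsProbabilityMeasure μ] {g v : α → ι → ℝ} {L : ℝ}
    (hg : ∀ i, Integrable (fun x => g x i) μ) (hv : ∀ i, Integrable (fun x => v x i) μ)
    (hgv : ∀ x i j, |g x i - g x j| ≤ L * |v x i - v x j|) (A : ι → ℝ) :
    ∫ x, ⨆ i, (A i + (∫ y, g y i ∂μ - g x i)) ∂μ ≤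
      (1 / 2) * ∫ x, ((⨆ i, (A i + 2 * L * v x i)) + ⨆ i, (A i + 2 * L * -v x i)) ∂μ := by
  have i1 : Integrable (fun x => ⨆ i, (A i + 2 * g x i)) μ :=
    integrable_iSup_fin fun i => (integrable_const _).add ((hg i).const_mul 2)
  have i2 : Integrable (fun x => ⨆ i, (A i - 2 * g x i)) μ :=
    integrable_iSup_fin fun i => (integrable_const _).sub ((hg i).const_mul 2)
  have i3 : Integrable (fun x => ⨆ i, (A i + 2 * L * v x i)) μ :=
    integrable_iSup_fin fun i => (integrable_const _).add ((hv i).const_mul _)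
  have i4 : Integrable (fun x => ⨆ i, (A i + 2 * L * -v x i)) μ :=
    integrable_iSup_fin fun i => (integrable_const _).add ((hv i).neg.const_mul _)
  -- Splitting `A i` into halves gives `A i + E g i - g x i = (A i + 2 E g i) / 2 + (A i - 2 g x i)
  -- / 2`; Jensen's inequality handles the first half without introducing random signs.
  have step1 : ∀ x, ⨆ i, (A i + (∫ y, g y i ∂μ - g x i)) ≤
      (1 / 2) * ∫ y, (⨆ i, (A i + 2 * g y i)) ∂μ + (1 / 2) * ⨆ i, (A i - 2 * g x i) := by
    intro x
    refine iSup_fin_le_iff.2 fun i => ?_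
    have h1 : ∫ y, (A i + 2 * g y i) ∂μ ≤ ∫ y, (⨆ i, (A i + 2 * g y i)) ∂μ :=
      integral_mono ((integrable_const _).add ((hg i).const_mul 2)) i1
        fun y => le_iSup_fin (fun i => A i + 2 * g y i) i
    rw [integral_add (integrable_const _) ((hg i).const_mul 2), integral_const_mul] at h1
    have h2 := le_iSup_fin (fun i => A i - 2 * g x i) i
    simp only [integral_const, probReal_univ, one_smul] at h1
    linarith
  calc ∫ x, ⨆ i, (A i + (∫ y, g y i ∂μ - g x i)) ∂μ
      ≤ ∫ x, ((1 / 2) * ∫ y, (⨆ i, (A i + 2 * g y i)) ∂μ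
          + (1 / 2) * ⨆ i, (A i - 2 * g x i)) ∂μ :=
        integral_mono (integrable_iSup_fin fun i =>
          (integrable_const _).add ((integrable_const _).sub (hg i)))
          ((integrable_const _).add (i2.const_mul _)) step1
    _ = (1 / 2) * ∫ x, ((⨆ i, (A i + 2 * g x i)) + ⨆ i, (A i - 2 * g x i)) ∂μ := by
        rw [integral_add (integrable_const _) (i2.const_mul _), integral_add i1 i2]
        simp only [integral_const_mul, integral_const, probReal_univ, one_smul]
        ring
    _ ≤ _ := by
        refine mul_le_mul_of_nonneg_left (integral_mono (i1.add i2) (i3.add i4) fun x => ?_)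
          (by norm_num)
        -- Contraction: the left side is at most `A i + A j + 2 L |v x i - v x j|`, and the sign of
        -- `v x i - v x j` decides which index goes to which supremum.
        have : ∀ i j, (A i + 2 * g x i) + (A j - 2 * g x j) ≤
            (⨆ i, (A i + 2 * L * v x i)) + ⨆ i, (A i + 2 * L * -v x i) := by
          intro i j
          have e1 := le_iSup_fin (fun i => A i + 2 * L * v x i) i
          have e2 := le_iSup_fin (fun i => A i + 2 * L * v x i) j
          have e3 := le_iSup_fin (fun i => A i + 2 * L * -v x i) i
          have e4 := le_iSup_fin (fun i => A i + 2 * L * -v x i) j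
          have h := (le_abs_self _).trans (hgv x i j)
          rcases abs_cases (v x i - v x j) with ⟨h', _⟩ | ⟨h', _⟩ <;> rw [h'] at h <;> nlinarith
        have h1 : ∀ j, (⨆ i, (A i + 2 * g x i)) ≤
            (⨆ i, (A i + 2 * L * v x i)) + (⨆ i, (A i + 2 * L * -v x i)) - (A j - 2 * g x j) :=
          fun j => iSup_fin_le_iff.2 fun i => by linarith [this i j]
        have h2 : (⨆ j, (A j - 2 * g x j)) ≤ (⨆ i, (A i + 2 * L * v x i)) +
            (⨆ i, (A i + 2 * L * -v x i)) - ⨆ i, (A i + 2 * g x i) :=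
          iSup_fin_le_iff.2 fun j => by linarith [h1 j]
        simp only
        linarith

lemma integrable_sum_pi {α : Type*} [MeasurableSpace α] {μ : Measure α} [IsProbabilityMeasure μ]
    {n : ℕ} {f : α → ℝ} (hf : Integrable f μ) :
    Integrable (fun x : Fin n → α => ∑ k, f (x k)) (Measure.pi fun _ => μ) :=
  integrable_finsetSum _ fun k _ => integrable_comp_eval (i := k) hf

/-- A one-step comparison of expected maxima tensorizes to i.i.d. sums. -/
lemma integral_iSup_sum_le [Nonempty ι] {α γ : Type*} [MeasurableSpace α]
    [MeasurableSpace γ] {μ : Measure α} {ν : Measure γ} [IsProbabilityMeasure μ]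
    [IsProbabilityMeasure ν] {f : α → ι → ℝ} {h : γ → ι → ℝ}
    (hf : ∀ i, Integrable (fun x => f x i) μ) (hh : ∀ i, Integrable (fun x => h x i) ν)
    (step : ∀ A : ι → ℝ, ∫ x, ⨆ i, (A i + f x i) ∂μ ≤ ∫ x, ⨆ i, (A i + h x i) ∂ν)
    (n : ℕ) (A : ι → ℝ) :
    ∫ x : Fin n → α, ⨆ i, (A i + ∑ k, f (x k) i) ∂(Measure.pi fun _ => μ) ≤
      ∫ x : Fin n → γ, ⨆ i, (A i + ∑ k, h (x k) i) ∂(Measure.pi fun _ => ν) := by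
  induction n generalizing A with
  | zero => simp
  | succ n ih =>
    have e1 := (measurePreserving_piFinSuccAbove (fun _ : Fin (n + 1) => μ) 0).symm
    have e2 := (measurePreserving_piFinSuccAbove (fun _ : Fin (n + 1) => ν) 0).symm
    rw [← e1.integral_comp', ← e2.integral_comp']
    have if1 : Integrable (fun z : α × (Fin n → α) => ⨆ i, (A i + (f z.1 i + ∑ k, f (z.2 k) i)))
        (μ.prod (Measure.pi fun _ => μ)) := integrable_iSup_fin fun i =>
      (integrable_const _).add (((hf i).comp_fst _).add ((integrable_sum_pi (hf i)).comp_snd _))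
    have if2 : Integrable (fun z : α × (Fin n → γ) => ⨆ i, (A i + (f z.1 i + ∑ k, h (z.2 k) i)))
        (μ.prod (Measure.pi fun _ => ν)) := integrable_iSup_fin fun i =>
      (integrable_const _).add (((hf i).comp_fst _).add ((integrable_sum_pi (hh i)).comp_snd _))
    have if3 : Integrable (fun z : γ × (Fin n → γ) => ⨆ i, (A i + (h z.1 i + ∑ k, h (z.2 k) i)))
        (ν.prod (Measure.pi fun _ => ν)) := integrable_iSup_fin fun i =>
      (integrable_const _).add (((hh i).comp_fst _).add ((integrable_sum_pi (hh i)).comp_snd _))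
    simp only [MeasurableEquiv.piFinSuccAbove_symm_apply, Fin.sum_univ_succ, Fin.insertNthEquiv_zero,
      Fin.consEquiv_apply, Fin.cons_zero, Fin.cons_succ]
    rw [integral_prod _ if1, integral_prod_symm _ if3]
    -- Freezing the first observation and absorbing it into `A` lets the induction hypothesis
    -- replace the others; Fubini then allows the first one to be replaced with the others frozen.
    calc ∫ x, ∫ y : Fin n → α, ⨆ i, (A i + (f x i + ∑ k, f (y k) i)) ∂(Measure.pi fun _ => μ) ∂μ
        ≤ ∫ x, ∫ y : Fin n → γ, ⨆ i, (A i + (f x i + ∑ k, h (y k) i))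
            ∂(Measure.pi fun _ => ν) ∂μ := by
          refine integral_mono if1.integral_prod_left if2.integral_prod_left fun x => ?_
          simpa only [add_assoc] using ih fun i => A i + f x i
      _ = ∫ y : Fin n → γ, ∫ x, ⨆ i, (A i + (f x i + ∑ k, h (y k) i)) ∂μ
            ∂(Measure.pi fun _ => ν) := by
          rw [← integral_prod _ if2, integral_prod_symm _ if2]
      _ ≤ _ := by
          refine integral_mono if2.integral_prod_right if3.integral_prod_right fun y => ?_
          have := step fun i => A i + ∑ k, h (y k) i
          simpa only [add_assoc, add_comm (∑ k, h (y k) _)] using this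

end FiniteMax

/-! ### Maxima of subgaussian sums -/

lemma l1norm_nonneg {p : ℕ} (b : Fin p → ℝ) : 0 ≤ l1norm b :=
  Finset.sum_nonneg fun _ _ => abs_nonneg _

lemma dotProduct_le_l1norm_mul {p : ℕ} (d x : Fin p → ℝ) {u : ℝ} (hx : ∀ j, |x j| ≤ u) :
    |d ⬝ᵥ x| ≤ l1norm d * u := by
  unfold dotProduct l1norm
  rw [Finset.sum_mul]
  refine (Finset.abs_sum_le_sum_abs _ _).trans (Finset.sum_le_sum fun j _ => ?_)
  rw [abs_mul]
  exact mul_le_mul_of_nonneg_left (hx j) (abs_nonneg _)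

/-- `log (p ∨ 2)`. -/
noncomputable def logDim (p : ℕ) : ℝ := Real.log (max (p : ℝ) 2)

lemma half_le_logDim (p : ℕ) : 1 / 2 ≤ logDim p := by
  have h1 : Real.log 2 ≤ logDim p := Real.log_le_log (by norm_num) (le_max_right _ _)
  linarith [Real.log_two_gt_d9]

lemma logDim_pos (p : ℕ) : 0 < logDim p := by linarith [half_le_logDim p]

lemma integrable_exp_sum_coord {p n : ℕ} {ν : Measure (Fin p → ℝ)} [IsProbabilityMeasure ν]
    {j : Fin p} {r : ℝ} (h : Integrable (fun x => Real.exp (r * x j)) ν) :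
    Integrable (fun x : Fin n → Fin p → ℝ => Real.exp (r * ∑ k, x k j))
      (Measure.pi fun _ => ν) := by
  simp only [Finset.mul_sum, Real.exp_sum]
  exact Integrable.fintype_prod (f := fun _ (x : Fin p → ℝ) => Real.exp (r * x j)) fun _ => h

lemma integral_exp_sum_coord_le {p n : ℕ} {ν : Measure (Fin p → ℝ)} [IsProbabilityMeasure ν]
    {j : Fin p} {c S : ℝ≥0} (h : HasSubgaussianMGF (fun x : Fin p → ℝ => x j) c ν) (hc : c ≤ S)
    (r : ℝ) :
    ∫ x : Fin n → Fin p → ℝ, Real.exp (r * ∑ k, x k j) ∂(Measure.pi fun _ => ν) ≤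
      Real.exp (n * (S * r ^ 2 / 2)) := by
  simp only [Finset.mul_sum, Real.exp_sum]
  rw [integral_fintype_prod_eq_pow (fun x : Fin p → ℝ => Real.exp (r * x j)), Real.exp_nat_mul,
    Fintype.card_fin]
  refine pow_le_pow_left₀ (integral_nonneg fun _ => (Real.exp_pos _).le) ?_ n
  refine (h.mgf_le r).trans (Real.exp_le_exp.2 ?_)
  have : (c : ℝ) ≤ S := hc
  gcongr

/-- The expected maximum of a linear process over an `ℓ¹` ball. -/
lemma integral_iSup_linear_le {ι : Type*} [Fintype ι] [Nonempty ι] {p n : ℕ} (hn : 0 < n)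
    {ν : Measure (Fin p → ℝ)} [IsProbabilityMeasure ν] {c : Fin p → ℝ≥0} {S : ℝ≥0}
    (h : ∀ j, HasSubgaussianMGF (fun x : Fin p → ℝ => x j) (c j) ν) (hc : ∀ j, c j ≤ S)
    {D : ι → Fin p → ℝ} {t K : ℝ} (ht : ∀ i, l1norm (D i) ≤ t) (hK : 0 ≤ K) :
    ∫ x : Fin n → Fin p → ℝ, ⨆ i, (0 + ∑ k, K * (D i ⬝ᵥ x k)) ∂(Measure.pi fun _ => ν) ≤
      K * t * ((5 + S / 2) * √(n * logDim p)) := by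
  have hl := logDim_pos p
  have hn' : (0 : ℝ) < n := Nat.cast_pos.2 hn
  set l := logDim p with hl_def
  set s := √(l / n) with hs_def
  have hs : 0 < s := Real.sqrt_pos.2 (div_pos hl hn')
  have hs2 : s ^ 2 = l / n := Real.sq_sqrt (div_pos hl hn').le
  -- With this shift each `exp (± s ∑ x k j - e)` has mean at most `exp (-l) = 1 / max p 2`, so all
  -- `2 p` of them together have mean at most `2`. The bound `u ≤ e + exp (u - e)` then controls the
  -- maximum by the integrable function `U`.
  set e := l + S * l / 2 with he_def
  have he : 0 ≤ e := by positivity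
  have ht0 : 0 ≤ t := (l1norm_nonneg _).trans (ht (Classical.arbitrary ι))
  set U : (Fin n → Fin p → ℝ) → ℝ := fun x =>
    e + ∑ j, (Real.exp (s * ∑ k, x k j) + Real.exp (-s * ∑ k, x k j)) * Real.exp (-e) with hU
  have hpt : ∀ x : Fin n → Fin p → ℝ, (⨆ i, (0 + ∑ k, K * (D i ⬝ᵥ x k))) ≤ K * t * (U x / s) := by
    intro x
    have hS : ∀ j, |∑ k, x k j| ≤ U x / s := by
      intro j
      rw [le_div_iff₀ hs]
      have h1 : ∀ u : ℝ, u ≤ e + Real.exp u * Real.exp (-e) := by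
        intro u
        rw [← Real.exp_add]
        linarith [Real.add_one_le_exp (u + -e)]
      have h2 : (Real.exp (s * ∑ k, x k j) + Real.exp (-s * ∑ k, x k j)) * Real.exp (-e) ≤
          ∑ j, (Real.exp (s * ∑ k, x k j) + Real.exp (-s * ∑ k, x k j)) * Real.exp (-e) :=
        Finset.single_le_sum (f := fun j => (Real.exp (s * ∑ k, x k j) +
          Real.exp (-s * ∑ k, x k j)) * Real.exp (-e)) (fun _ _ => by positivity)
          (Finset.mem_univ j)
      have h3 := h1 (s * ∑ k, x k j)
      have h4 := h1 (-s * ∑ k, x k j)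
      have p1 := mul_pos (Real.exp_pos (s * ∑ k, x k j)) (Real.exp_pos (-e))
      have p2 := mul_pos (Real.exp_pos (-s * ∑ k, x k j)) (Real.exp_pos (-e))
      simp only [hU]
      rcases abs_cases (∑ k, x k j) with ⟨h', _⟩ | ⟨h', _⟩ <;> rw [h'] <;> linarith
    refine iSup_fin_le_iff.2 fun i => ?_
    have h5 : ∑ k, K * (D i ⬝ᵥ x k) = K * (D i ⬝ᵥ fun j => ∑ k, x k j) := by
      rw [← Finset.mul_sum]
      congr 1
      simp only [dotProduct, Finset.mul_sum]
      exact Finset.sum_comm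
    rw [zero_add, h5, mul_assoc]
    refine mul_le_mul_of_nonneg_left ?_ hK
    refine (le_abs_self _).trans ((dotProduct_le_l1norm_mul _ _ hS).trans ?_)
    refine mul_le_mul_of_nonneg_right (ht i) (div_nonneg ?_ hs.le)
    exact add_nonneg he (Finset.sum_nonneg fun _ _ => by positivity)
  have hint : ∀ j (r : ℝ), Integrable (fun x : Fin n → Fin p → ℝ => Real.exp (r * ∑ k, x k j))
      (Measure.pi fun _ => ν) := fun j r => integrable_exp_sum_coord ((h j).integrable_exp_mul r)
  have hUj : ∀ j ∈ Finset.univ, Integrable (fun x : Fin n → Fin p → ℝ =>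
      (Real.exp (s * ∑ k, x k j) + Real.exp (-s * ∑ k, x k j)) * Real.exp (-e))
      (Measure.pi fun _ => ν) := fun j _ => ((hint j s).add (hint j (-s))).mul_const _
  have hUi : Integrable U (Measure.pi fun _ => ν) :=
    (integrable_const _).add (integrable_finsetSum _ hUj)
  have hUint : ∫ x, U x ∂(Measure.pi fun _ => ν) ≤ (5 + S / 2) * l := by
    simp only [hU]
    rw [integral_add (integrable_const _) (integrable_finsetSum _ hUj), integral_finsetSum _ hUj]
    have h6 : ∀ j, ∫ x : Fin n → Fin p → ℝ, (Real.exp (s * ∑ k, x k j) +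
        Real.exp (-s * ∑ k, x k j)) * Real.exp (-e) ∂(Measure.pi fun _ => ν) ≤
          2 / max (p : ℝ) 2 := by
      intro j
      rw [integral_mul_const, integral_add (hint j s) (hint j (-s))]
      have h7 := integral_exp_sum_coord_le (n := n) (h j) (hc j) s
      have h8 := integral_exp_sum_coord_le (n := n) (h j) (hc j) (-s)
      rw [neg_sq] at h8
      have h9 : (n : ℝ) * (S * s ^ 2 / 2) = S * l / 2 := by
        rw [hs2]; field_simp
      rw [h9] at h7 h8
      have h10 : Real.exp (S * l / 2) * Real.exp (-e) = (max (p : ℝ) 2)⁻¹ := by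
        rw [← Real.exp_add, he_def, show S * l / 2 + -(l + S * l / 2) = -l by ring, Real.exp_neg,
          hl_def, logDim, Real.exp_log (by positivity)]
      rw [div_eq_mul_inv, ← h10, ← mul_assoc]
      refine mul_le_mul_of_nonneg_right ?_ (Real.exp_pos _).le
      linarith
    have h7 : ∑ j : Fin p, ∫ x : Fin n → Fin p → ℝ, (Real.exp (s * ∑ k, x k j) +
        Real.exp (-s * ∑ k, x k j)) * Real.exp (-e) ∂(Measure.pi fun _ => ν) ≤ 2 := by
      refine (Finset.sum_le_sum fun j _ => h6 j).trans ?_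
      rw [Finset.sum_const, Finset.card_univ, Fintype.card_fin, nsmul_eq_mul, mul_div_assoc',
        div_le_iff₀ (by positivity), mul_comm]
      exact mul_le_mul_of_nonneg_left (le_max_left _ _) (by norm_num)
    simp only [integral_const, probReal_univ, one_smul]
    -- The remaining additive `2` is at most `4 l`, whence the constant `5` in the bound.
    have := half_le_logDim p
    rw [he_def]
    nlinarith
  calc ∫ x : Fin n → Fin p → ℝ, ⨆ i, (0 + ∑ k, K * (D i ⬝ᵥ x k)) ∂(Measure.pi fun _ => ν)
      ≤ ∫ x, K * t * (U x / s) ∂(Measure.pi fun _ => ν) := by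
        refine integral_mono (integrable_iSup_fin fun i => ?_) ((hUi.div_const _).const_mul _) hpt
        refine (integrable_const _).add ?_
        refine integrable_sum_pi (f := fun x : Fin p → ℝ => K * (D i ⬝ᵥ x)) ?_
        exact (integrable_finsetSum _ fun j _ => ((h j).integrable).const_mul (D i j)).const_mul _
    _ = K * t * ((∫ x, U x ∂(Measure.pi fun _ => ν)) / s) := by
        rw [integral_const_mul, integral_div]
    _ ≤ K * t * (((5 + S / 2) * l) / s) := by gcongr
    _ = _ := by
        have h8 : l / s = √(n * l) := by
          rw [div_eq_iff hs.ne', hs_def, ← Real.sqrt_mul (by positivity),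
            show (n : ℝ) * l * (l / n) = l ^ 2 by field_simp, Real.sqrt_sq hl.le]
        rw [mul_div_assoc, h8]

/-! ### The loss and the risk -/

section Loss

variable {ρ : ℝ → Fin 2 → ℝ} {L : ℝ≥0}

lemma abs_loss_sub_le (hlip : ∀ y, LipschitzWith L (fun t => ρ t y)) (y : Fin 2) (s t : ℝ) :
    |ρ s y - ρ t y| ≤ L * |s - t| := by
  simpa [Real.dist_eq] using (hlip y).dist_le_mul s t

lemma measurable_loss (hlip : ∀ y, LipschitzWith L (fun t => ρ t y)) {α : Type*}
    [MeasurableSpace α] {f : α → ℝ} {g : α → Fin 2} (hf : Measurable f) (hg : Measurable g) :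
    Measurable fun x => ρ (f x) (g x) := by
  have : Measurable fun q : ℝ × Fin 2 => ρ q.1 q.2 :=
    measurable_from_prod_countable_left fun y => (hlip y).continuous.measurable
  exact this.comp (hf.prodMk hg)

lemma integrable_dotProduct {p : ℕ} {μ : Measure (Obs p)}
    (hX : ∀ j, Integrable (fun z : Obs p => z.1 j) μ) (b : Fin p → ℝ) :
    Integrable (fun z : Obs p => b ⬝ᵥ z.1) μ :=
  integrable_finsetSum _ fun j _ => (hX j).const_mul (b j)

lemma measurable_dotProduct_fst {p : ℕ} (b : Fin p → ℝ) :
    Measurable (fun z : Obs p => b ⬝ᵥ z.1) := by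
  unfold dotProduct; fun_prop

lemma integrable_loss {p : ℕ} {μ : Measure (Obs p)} [IsProbabilityMeasure μ]
    (hlip : ∀ y, LipschitzWith L (fun t => ρ t y))
    (hX : ∀ j, Integrable (fun z : Obs p => z.1 j) μ) (b : Fin p → ℝ) :
    Integrable (fun z : Obs p => ρ (b ⬝ᵥ z.1) z.2) μ := by
  refine Integrable.mono' (g := fun z => (|ρ 0 0| + |ρ 0 1|) + L * |b ⬝ᵥ z.1|)
    ((integrable_const _).add ((integrable_dotProduct hX b).abs.const_mul _))
    (measurable_loss hlip (measurable_dotProduct_fst b) measurable_snd).aestronglyMeasurable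
    (ae_of_all _ fun z => ?_)
  have h1 := abs_loss_sub_le hlip z.2 (b ⬝ᵥ z.1) 0
  have h2 : |ρ 0 z.2| ≤ |ρ 0 0| + |ρ 0 1| := by
    rcases Fin.exists_fin_two.1 ⟨z.2, rfl⟩ with h | h <;> rw [h] <;> simp
  rw [sub_zero] at h1
  rw [Real.norm_eq_abs]
  have h3 := abs_add_le (ρ (b ⬝ᵥ z.1) z.2 - ρ 0 z.2) (ρ 0 z.2)
  rw [sub_add_cancel] at h3
  linarith

lemma continuous_risk {p : ℕ} {μ : Measure (Obs p)} [IsProbabilityMeasure μ]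
    (hlip : ∀ y, LipschitzWith L (fun t => ρ t y))
    (hX : ∀ j, Integrable (fun z : Obs p => z.1 j) μ) : Continuous (risk ρ μ) := by
  have hK : ∀ b c : Fin p → ℝ, |risk ρ μ b - risk ρ μ c| ≤
      (L * ∑ j, ∫ z, |z.1 j| ∂μ) * dist b c := by
    intro b c
    unfold risk
    rw [← integral_sub (integrable_loss hlip hX b) (integrable_loss hlip hX c)]
    refine (abs_integral_le_integral_abs).trans ?_
    have hi : Integrable (fun z : Obs p => ∑ j, |z.1 j|) μ :=
      integrable_finsetSum _ fun j _ => (hX j).abs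
    calc ∫ z, |ρ (b ⬝ᵥ z.1) z.2 - ρ (c ⬝ᵥ z.1) z.2| ∂μ
        ≤ ∫ z, (L * dist b c) * ∑ j, |z.1 j| ∂μ := by
          refine integral_mono ((integrable_loss hlip hX b).sub (integrable_loss hlip hX c)).abs
            (hi.const_mul _) fun z => (abs_loss_sub_le hlip _ _ _).trans ?_
          rw [← sub_dotProduct, mul_assoc]
          refine mul_le_mul_of_nonneg_left ?_ L.2
          unfold dotProduct
          rw [Finset.mul_sum]
          refine (Finset.abs_sum_le_sum_abs _ _).trans (Finset.sum_le_sum fun j _ => ?_)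
          rw [abs_mul]
          exact mul_le_mul_of_nonneg_right (dist_le_pi_dist b c j) (abs_nonneg _)
      _ = _ := by
          rw [integral_const_mul, integral_finsetSum _ fun j _ => (hX j).abs]
          ring
  have hK0 : 0 ≤ L * ∑ j, ∫ z, |z.1 j| ∂μ :=
    mul_nonneg L.2 (Finset.sum_nonneg fun j _ => integral_nonneg fun _ => abs_nonneg _)
  exact (LipschitzWith.of_dist_le_mul (K := ⟨_, hK0⟩) fun b c => hK b c).continuous

lemma continuous_empRisk {p n : ℕ} (hlip : ∀ y, LipschitzWith L (fun t => ρ t y))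
    (z : Fin n → Obs p) : Continuous (empRisk ρ z) := by
  unfold empRisk
  refine continuous_const.mul (continuous_finsetSum _ fun i _ => ?_)
  exact (hlip (z i).2).continuous.comp (by unfold dotProduct; fun_prop)

/-! ### The tail of the centered empirical process -/

/-- The symmetrized law of the predictors. -/
noncomputable def symLaw {p : ℕ} (μ : Measure (Obs p)) : Measure (Fin p → ℝ) :=
  (1 / 2 : ℝ≥0∞) • (μ.map Prod.fst + μ.map fun z => -z.1)

instance isProbabilityMeasure_symLaw {p : ℕ} (μ : Measure (Obs p)) [IsProbabilityMeasure μ] :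
    IsProbabilityMeasure (symLaw μ) := by
  have h1 : IsProbabilityMeasure (μ.map Prod.fst) :=
    Measure.isProbabilityMeasure_map (by fun_prop)
  have h2 : IsProbabilityMeasure (μ.map fun z : Obs p => -z.1) :=
    Measure.isProbabilityMeasure_map (by fun_prop)
  refine ⟨?_⟩
  rw [symLaw, Measure.smul_apply, Measure.add_apply, measure_univ, measure_univ, smul_eq_mul,
    one_add_one_eq_two, one_div, ENNReal.inv_mul_cancel (by simp) (by simp)]

lemma integrable_symLaw {p : ℕ} {μ : Measure (Obs p)} {F : (Fin p → ℝ) → ℝ} (hF : Measurable F)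
    (h1 : Integrable (fun z : Obs p => F z.1) μ) (h2 : Integrable (fun z : Obs p => F (-z.1)) μ) :
    Integrable F (symLaw μ) := by
  refine Integrable.smul_measure ?_ (by simp)
  refine Integrable.add_measure ?_ ?_
  · exact (integrable_map_measure hF.aestronglyMeasurable (by fun_prop)).2 h1
  · exact (integrable_map_measure hF.aestronglyMeasurable (by fun_prop)).2 h2

lemma integral_symLaw {p : ℕ} {μ : Measure (Obs p)} {F : (Fin p → ℝ) → ℝ} (hF : Measurable F)
    (h1 : Integrable (fun z : Obs p => F z.1) μ) (h2 : Integrable (fun z : Obs p => F (-z.1)) μ) :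
    ∫ x, F x ∂(symLaw μ) = (1 / 2) * ∫ z, (F z.1 + F (-z.1)) ∂μ := by
  rw [symLaw, integral_smul_measure, integral_add_measure, integral_map (by fun_prop)
    hF.aestronglyMeasurable, integral_map (by fun_prop) hF.aestronglyMeasurable,
    integral_add h1 h2]
  · simp
  · exact (integrable_map_measure hF.aestronglyMeasurable (by fun_prop)).2 h1
  · exact (integrable_map_measure hF.aestronglyMeasurable (by fun_prop)).2 h2

/-- The moment generating function under the mixture is the average of those of `X j` and `-X j`,
which obey the same bound. -/
lemma hasSubgaussianMGF_symLaw {p : ℕ} {μ : Measure (Obs p)} {j : Fin p} {c : ℝ≥0}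
    (h : HasSubgaussianMGF (fun z : Obs p => z.1 j) c μ) :
    HasSubgaussianMGF (fun x : Fin p → ℝ => x j) c (symLaw μ) := by
  have h1 : ∀ t, Integrable (fun z : Obs p => Real.exp (t * (-z.1) j)) μ := by
    simpa using h.neg.integrable_exp_mul
  refine ⟨fun t => integrable_symLaw (by fun_prop) (h.integrable_exp_mul t) (h1 t), fun t => ?_⟩
  have h2 := h.mgf_le t
  have h3 := h.neg.mgf_le t
  unfold mgf at h2 h3 ⊢
  rw [integral_symLaw (by fun_prop) (h.integrable_exp_mul t) (h1 t),
    integral_add (h.integrable_exp_mul t) (h1 t)]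
  simp only [Pi.neg_apply] at h3 ⊢
  linarith

/-- The centered empirical process, up to the factor `n`. -/
noncomputable def centeredProcess {p n : ℕ} (ρ : ℝ → Fin 2 → ℝ) (μ : Measure (Obs p))
    (b₀ b : Fin p → ℝ) (z : Fin n → Obs p) : ℝ :=
  ∑ k, ((risk ρ μ b - risk ρ μ b₀) - (ρ (b ⬝ᵥ (z k).1) (z k).2 - ρ (b₀ ⬝ᵥ (z k).1) (z k).2))

lemma centeredProcess_eq {p n : ℕ} (hn : 0 < n) (μ : Measure (Obs p)) (b₀ b : Fin p → ℝ)
    (z : Fin n → Obs p) :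
    centeredProcess ρ μ b₀ b z =
      n * ((risk ρ μ b - risk ρ μ b₀) - (empRisk ρ z b - empRisk ρ z b₀)) := by
  have hn' : (n : ℝ) ≠ 0 := Nat.cast_ne_zero.2 hn.ne'
  unfold centeredProcess empRisk
  rw [Finset.sum_sub_distrib, Finset.sum_sub_distrib (f := fun k => ρ (b ⬝ᵥ (z k).1) (z k).2)]
  simp only [Finset.sum_const, Finset.card_univ, Fintype.card_fin, nsmul_eq_mul]
  field_simp

/-- Markov's inequality for the maximum over finitely many points. Having the center `b₀` among them
makes the maximum nonnegative; its mean is compared with that of the linear process `2 L (b i -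
b₀)ᵀx` under the symmetrized law. -/
lemma measure_exists_le_centeredProcess_le {ι : Type*} [Fintype ι] {p n : ℕ} (hn : 0 < n)
    {μ : Measure (Obs p)} [IsProbabilityMeasure μ]
    (hlip : ∀ y, LipschitzWith L (fun t => ρ t y)) {c : Fin p → ℝ≥0} {S : ℝ≥0}
    (h : ∀ j, HasSubgaussianMGF (fun z : Obs p => z.1 j) (c j) μ) (hc : ∀ j, c j ≤ S)
    {b₀ : Fin p → ℝ} {b : ι → Fin p → ℝ} {i₀ : ι} (hi₀ : b i₀ = b₀) {t τ : ℝ} (hτ : 0 < τ)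
    (ht : ∀ i, l1norm (b i - b₀) ≤ t) :
    (Measure.pi fun _ : Fin n => μ) {z | ∃ i, τ ≤ centeredProcess ρ μ b₀ (b i) z} ≤
      ENNReal.ofReal (2 * L * t * ((5 + S / 2) * √(n * logDim p)) / τ) := by
  have : Nonempty ι := ⟨i₀⟩
  have hX : ∀ j, Integrable (fun z : Obs p => z.1 j) μ := fun j => (h j).integrable
  set f : Obs p → ι → ℝ := fun z i => (risk ρ μ (b i) - risk ρ μ b₀) -
    (ρ (b i ⬝ᵥ z.1) z.2 - ρ (b₀ ⬝ᵥ z.1) z.2) with hf_def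
  set M : (Fin n → Obs p) → ℝ := fun z => ⨆ i, (0 + ∑ k, f (z k) i) with hM_def
  have hg : ∀ i, Integrable (fun z : Obs p => ρ (b i ⬝ᵥ z.1) z.2 - ρ (b₀ ⬝ᵥ z.1) z.2) μ :=
    fun i => (integrable_loss hlip hX _).sub (integrable_loss hlip hX _)
  have hf : ∀ i, Integrable (fun z => f z i) μ := fun i => (integrable_const _).sub (hg i)
  have hMi : Integrable M (Measure.pi fun _ => μ) :=
    integrable_iSup_fin fun i => (integrable_const _).add (integrable_sum_pi (hf i))
  have hM0 : ∀ z, 0 ≤ M z := by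
    intro z
    have h1 : 0 + ∑ k, f (z k) i₀ = 0 := by simp [hf_def, hi₀]
    exact h1.ge.trans (le_iSup_fin (fun i => 0 + ∑ k, f (z k) i) i₀)
  have hv : ∀ i, Integrable (fun z : Obs p => (b i - b₀) ⬝ᵥ z.1) μ :=
    fun i => integrable_dotProduct hX _
  have hv' : ∀ i, Integrable (fun z : Obs p => (b i - b₀) ⬝ᵥ -z.1) μ := fun i => by
    simp only [dotProduct_neg]
    exact (hv i).neg
  have hm : ∀ i, Measurable fun x : Fin p → ℝ => (b i - b₀) ⬝ᵥ x := fun i => by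
    unfold dotProduct; fun_prop
  have hh : ∀ i, Integrable (fun x => 2 * L * ((b i - b₀) ⬝ᵥ x)) (symLaw μ) := fun i =>
    (integrable_symLaw (hm i) (hv i) (hv' i)).const_mul _
  have hbound : ∫ z, M z ∂(Measure.pi fun _ => μ) ≤
      2 * L * t * ((5 + S / 2) * √(n * logDim p)) := by
    refine (integral_iSup_sum_le (ν := symLaw μ) (h := fun x i => 2 * L * ((b i - b₀) ⬝ᵥ x))
      hf hh (fun A => ?_) n fun _ => 0).trans
      (integral_iSup_linear_le hn (fun j => hasSubgaussianMGF_symLaw (h j)) hc ht (by positivity))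
    have key := integral_iSup_centered_le (μ := μ)
      (g := fun z i => ρ (b i ⬝ᵥ z.1) z.2 - ρ (b₀ ⬝ᵥ z.1) z.2)
      (v := fun z i => (b i - b₀) ⬝ᵥ z.1) (L := L) hg hv (fun z i j => ?_) A
    · rw [integral_symLaw]
      · simp only [dotProduct_neg]
        simp only [integral_sub (integrable_loss hlip hX _) (integrable_loss hlip hX _)] at key
        exact key
      · exact Measurable.iSup fun i => measurable_const.add ((hm i).const_mul _)
      · exact integrable_iSup_fin fun i => (integrable_const _).add ((hv i).const_mul _)
      · refine integrable_iSup_fin fun i => (integrable_const _).add (Integrable.const_mul ?_ _)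
        exact hv' i
    · have := abs_loss_sub_le hlip z.2 (b i ⬝ᵥ z.1) (b j ⬝ᵥ z.1)
      simpa [sub_dotProduct] using this
  have hmarkov := mul_meas_ge_le_integral_of_nonneg (ae_of_all _ hM0) hMi τ
  have hsub : {z | ∃ i, τ ≤ centeredProcess ρ μ b₀ (b i) z} ⊆ {z | τ ≤ M z} := by
    rintro z ⟨i, hi⟩
    refine hi.trans ?_
    have := le_iSup_fin (fun i => 0 + ∑ k, f (z k) i) i
    simpa [hf_def, centeredProcess, hM_def] using this
  refine (measure_mono hsub).trans ?_
  rw [← ENNReal.ofReal_toReal (measure_ne_top (Measure.pi fun _ : Fin n => μ) {z | τ ≤ M z})]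
  refine ENNReal.ofReal_le_ofReal ?_
  rw [le_div_iff₀ hτ, mul_comm]
  exact hmarkov.trans hbound

/-- The centered empirical process exceeds `τ` on the `ℓ¹` ball of radius `t` around `b₀`. -/
def deviationSet {p n : ℕ} (ρ : ℝ → Fin 2 → ℝ) (μ : Measure (Obs p)) (b₀ : Fin p → ℝ) (t τ : ℝ) :
    Set (Fin n → Obs p) :=
  {z | ∃ b, l1norm (b - b₀) ≤ t ∧
    τ < (risk ρ μ b - risk ρ μ b₀) - (empRisk ρ z b - empRisk ρ z b₀)}

/-- The strict inequality defining the event is an open condition on `b`, so a countable dense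
subset of the ball detects it. Increasing finite families and continuity from below reduce the claim
to the finite case, with a bound that does not depend on the number of points. -/
lemma measure_deviationSet_le {p n : ℕ} (hn : 0 < n)
    {μ : Measure (Obs p)} [IsProbabilityMeasure μ]
    (hlip : ∀ y, LipschitzWith L (fun t => ρ t y)) {c : Fin p → ℝ≥0} {S : ℝ≥0}
    (h : ∀ j, HasSubgaussianMGF (fun z : Obs p => z.1 j) (c j) μ) (hc : ∀ j, c j ≤ S)
    (b₀ : Fin p → ℝ) {t τ : ℝ} (hτ : 0 < τ) (ht : 0 ≤ t) :
    (Measure.pi fun _ : Fin n => μ) (deviationSet ρ μ b₀ t τ) ≤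
      ENNReal.ofReal (2 * L * (5 + S / 2) * (t * √(logDim p / n) / τ)) := by
  have hn' : (0 : ℝ) < n := Nat.cast_pos.2 hn
  have hX : ∀ j, Integrable (fun z : Obs p => z.1 j) μ := fun j => (h j).integrable
  let B : Set (Fin p → ℝ) := {b | l1norm (b - b₀) ≤ t}
  have h0 : b₀ ∈ B := by simpa [B, l1norm] using ht
  have : Nonempty B := ⟨⟨b₀, h0⟩⟩
  let d : ℕ → B := TopologicalSpace.denseSeq B
  -- The center is put at index `0`, so that every finite initial family contains it.
  let b : ℕ → Fin p → ℝ := fun k => Nat.casesOn k b₀ fun k => d k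
  have hbB : ∀ k, b k ∈ B := by
    rintro (_ | k)
    · exact h0
    · exact (d k).2
  let E : ℕ → Set (Fin n → Obs p) := fun m =>
    {z | ∃ i : Fin (m + 1), n * τ ≤ centeredProcess ρ μ b₀ (b i) z}
  have hE : Monotone E := by
    rintro m m' hm z ⟨i, hi⟩
    exact ⟨⟨i, by omega⟩, hi⟩
  have hsub : deviationSet ρ μ b₀ t τ ⊆ ⋃ m, E m := by
    rintro z ⟨b', hb', hz⟩
    let G : B → ℝ := fun b => (risk ρ μ b - risk ρ μ b₀) - (empRisk ρ z b - empRisk ρ z b₀)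
    have hG : Continuous G := by
      have h1 := (continuous_risk (ρ := ρ) hlip hX).comp (continuous_subtype_val (p := (· ∈ B)))
      have h2 := (continuous_empRisk hlip z).comp (continuous_subtype_val (p := (· ∈ B)))
      exact (h1.sub continuous_const).sub (h2.sub continuous_const)
    obtain ⟨k, hx⟩ := (TopologicalSpace.denseRange_denseSeq B).exists_mem_open
      (isOpen_lt continuous_const hG) ⟨⟨b', hb'⟩, hz⟩
    refine Set.mem_iUnion.2 ⟨k + 1, ⟨k + 1, by omega⟩, ?_⟩
    rw [centeredProcess_eq hn]
    exact mul_le_mul_of_nonneg_left (le_of_lt hx) hn'.le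
  refine (measure_mono hsub).trans ?_
  rw [hE.measure_iUnion]
  refine iSup_le fun m => ?_
  refine (measure_exists_le_centeredProcess_le (b := fun i : Fin (m + 1) => b i) (i₀ := 0) (t := t)
    hn hlip h hc rfl (mul_pos hn' hτ) fun i => hbB i).trans (le_of_eq ?_)
  congr 1
  have h8 : √(n * logDim p) = n * √(logDim p / n) := by
    rw [show (n : ℝ) * logDim p = n ^ 2 * (logDim p / n) by field_simp,
      Real.sqrt_mul (by positivity), Real.sqrt_sq hn'.le]
  rw [h8]
  field_simp

end Loss

/-! ### The pseudo-true vector is proportional to the true parameter -/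

/-- The right derivative serves: it is monotone, hence measurable, and testing the subgradient
inequality at `s ± 1` bounds it by the Lipschitz constant. -/
lemma ConvexOn.exists_measurable_subgradient {f : ℝ → ℝ} {L : ℝ≥0}
    (hf : ConvexOn ℝ Set.univ f) (hL : LipschitzWith L f) :
    ∃ g : ℝ → ℝ, Measurable g ∧ (∀ s, |g s| ≤ L) ∧ ∀ s t, f s + g s * (t - s) ≤ f t := by
  have hsub : ∀ s t, f s + derivWithin f (Set.Ioi s) s * (t - s) ≤ f t := by
    intro s t
    have hs : s ∈ interior (Set.univ : Set ℝ) := by simp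
    rcases lt_trichotomy s t with h | h | h
    · have h1 := hf.rightDeriv_le_slope_of_mem_interior hs (Set.mem_univ t) h
      rw [slope_def_field, le_div_iff₀ (sub_pos.2 h)] at h1
      linarith
    · simp [h]
    · have h1 := (hf.slope_le_leftDeriv_of_mem_interior (Set.mem_univ t) hs h).trans
        (hf.leftDeriv_le_rightDeriv_of_mem_interior hs)
      rw [slope_def_field, div_le_iff₀ (sub_pos.2 h)] at h1
      linarith
  refine ⟨fun s => derivWithin f (Set.Ioi s) s, ?_, fun s => ?_, hsub⟩
  · refine Monotone.measurable fun s t hst => ?_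
    rcases hst.eq_or_lt with rfl | hst
    · exact le_rfl
    · have h1 := hsub s t
      have h2 := hsub t s
      nlinarith [sub_pos.2 hst]
  · have h1 := hsub s (s + 1)
    have h2 := hsub s (s - 1)
    have h3 := hL.dist_le_mul (s + 1) s
    have h4 := hL.dist_le_mul (s - 1) s
    rw [Real.dist_eq, Real.dist_eq] at h3 h4
    simp only [add_sub_cancel_left, sub_sub_cancel_left, abs_neg, abs_one, mul_one] at h3 h4
    rw [abs_le] at h3 h4 ⊢
    constructor <;> linarith

/-- The function `exp (c t² / 2) - mgf X μ t` is nonnegative and vanishes at `0`, so its derivative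
there, which is `-E X`, is zero. -/
lemma ProbabilityTheory.HasSubgaussianMGF.integral_eq_zero {Ω : Type*} [MeasurableSpace Ω]
    {μ : Measure Ω} [IsProbabilityMeasure μ] {X : Ω → ℝ} {c : ℝ≥0}
    (h : HasSubgaussianMGF X c μ) : ∫ ω, X ω ∂μ = 0 := by
  have hint : (0 : ℝ) ∈ interior (integrableExpSet X μ) := by
    rw [h.integrableExpSet_eq_univ]; simp
  have hd : HasDerivAt (fun t => Real.exp (c * t ^ 2 / 2) - mgf X μ t) (0 - ∫ ω, X ω ∂μ) 0 := by
    refine HasDerivAt.sub ?_ (by simpa using hasDerivAt_mgf hint)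
    have : HasDerivAt (fun t : ℝ => c * t ^ 2 / 2) 0 0 := by
      simpa using (((hasDerivAt_id (0 : ℝ)).pow 2).const_mul (c : ℝ)).div_const 2
    simpa using this.exp
  have hmin : IsLocalMin (fun t => Real.exp (c * t ^ 2 / 2) - mgf X μ t) 0 := by
    refine Filter.Eventually.of_forall fun t => ?_
    simpa using h.mgf_le t
  simpa using hmin.hasDerivAt_eq_zero hd

/-- The `σ`-algebra generated by the predictors. -/
abbrev predictorAlgebra (p : ℕ) : MeasurableSpace (Obs p) :=
  MeasurableSpace.comap (fun z : Obs p => z.1) inferInstance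

/-- The `σ`-algebra generated by the linear index `βᵀX`. -/
abbrev indexAlgebra {p : ℕ} (β : Fin p → ℝ) : MeasurableSpace (Obs p) :=
  MeasurableSpace.comap (fun z : Obs p => β ⬝ᵥ z.1) inferInstance

section PseudoTrue

variable {p : ℕ} {μ : Measure (Obs p)} [IsProbabilityMeasure μ]

lemma LinearRegressions.exists_slope {β : Fin p → ℝ} (hlin : LinearRegressions μ β)
    (hX : ∀ j, Integrable (fun z : Obs p => z.1 j) μ) (h0 : ∀ j, ∫ z, z.1 j ∂μ = 0) :
    ∃ u : Fin p → ℝ, ∀ j,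
      μ[fun z : Obs p => z.1 j | indexAlgebra β]
        =ᵐ[μ] fun z => u j * (β ⬝ᵥ z.1) := by
  obtain ⟨u₀, u, hu⟩ := hlin
  refine ⟨u, fun j => ?_⟩
  have hm : MeasurableSpace.comap (fun z : Obs p => β ⬝ᵥ z.1) inferInstance ≤
      (inferInstance : MeasurableSpace (Obs p)) := (measurable_dotProduct_fst β).comap_le
  have hβ : ∫ z : Obs p, β ⬝ᵥ z.1 ∂μ = 0 := by
    unfold dotProduct
    rw [integral_finsetSum _ fun i _ => (hX i).const_mul _]
    simp [integral_const_mul, h0]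
  have h1 := integral_condExp (μ := μ) hm (f := fun z : Obs p => z.1 j)
  rw [integral_congr_ae (hu j), integral_add (integrable_const _)
    ((integrable_dotProduct hX β).const_mul _), integral_const_mul, hβ, h0 j] at h1
  have h2 : u₀ j = 0 := by simpa using h1
  simpa [h2] using hu j

/-- The regression residual of `X j` is orthogonal to bounded functions of `(Y, βᵀX)`, not only of
the index. Writing `G Y = G 0 + (G 1 - G 0) 1_{Y = 1}` and conditioning on `X` turns the indicator
into `q (βᵀX)`; the multiplier becomes a function of the index, given which the residual has mean
zero. -/
lemma integral_mul_residual_eq_zero {β u : Fin p → ℝ} {q : ℝ → ℝ}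
    (hX : ∀ j, Integrable (fun z : Obs p => z.1 j) μ) (hsemi : IsSemiparametric μ β q)
    (hu : ∀ j,
      μ[fun z : Obs p => z.1 j | indexAlgebra β]
        =ᵐ[μ] fun z => u j * (β ⬝ᵥ z.1))
    {G : Fin 2 → ℝ → ℝ} (hG : ∀ y, Measurable (G y)) {C : ℝ} (hC : ∀ y s, |G y s| ≤ C)
    (j : Fin p) :
    Integrable (fun z : Obs p => G z.2 (β ⬝ᵥ z.1) * (z.1 j - u j * (β ⬝ᵥ z.1))) μ ∧
      ∫ z : Obs p, G z.2 (β ⬝ᵥ z.1) * (z.1 j - u j * (β ⬝ᵥ z.1)) ∂μ = 0 := by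
  obtain ⟨hq, hqX⟩ := hsemi
  have hmXle : predictorAlgebra p ≤ (inferInstance : MeasurableSpace (Obs p)) :=
    measurable_fst.comap_le
  have hmβle : indexAlgebra β ≤ (inferInstance : MeasurableSpace (Obs p)) :=
    (measurable_dotProduct_fst β).comap_le
  set I : Obs p → ℝ := ({z : Obs p | z.2 = 1}).indicator fun _ => (1 : ℝ) with hI
  set V : Obs p → ℝ := fun z => z.1 j - u j * (β ⬝ᵥ z.1) with hV
  set F : Obs p → ℝ := fun z => (G 1 (β ⬝ᵥ z.1) - G 0 (β ⬝ᵥ z.1)) * V z with hF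
  set K : Obs p → ℝ := fun z => G 0 (β ⬝ᵥ z.1) +
    (G 1 (β ⬝ᵥ z.1) - G 0 (β ⬝ᵥ z.1)) * q (β ⬝ᵥ z.1) with hK
  have hVi : Integrable V μ := (hX j).sub ((integrable_dotProduct hX β).const_mul _)
  have hIm : Measurable I :=
    measurable_const.indicator (measurable_snd (measurableSet_singleton (1 : Fin 2)))
  have hIi : Integrable I μ :=
    (integrable_const (1 : ℝ)).indicator (measurable_snd (measurableSet_singleton (1 : Fin 2)))
  have hI1 : ∀ z, |I z| ≤ 1 := by
    intro z
    by_cases hz : z.2 = 1 <;> simp [hI, hz]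
  have hGm : ∀ y, Measurable fun z : Obs p => G y (β ⬝ᵥ z.1) :=
    fun y => (hG y).comp (measurable_dotProduct_fst β)
  have hG0 : Integrable (fun z => G 0 (β ⬝ᵥ z.1) * V z) μ :=
    hVi.bdd_mul (hGm 0).aestronglyMeasurable (ae_of_all _ fun z => hC 0 _)
  have hFi : Integrable F μ := by
    have h1 : Integrable (fun z => G 1 (β ⬝ᵥ z.1) * V z) μ :=
      hVi.bdd_mul (hGm 1).aestronglyMeasurable (ae_of_all _ fun z => hC 1 _)
    refine (h1.sub hG0).congr (ae_of_all _ fun z => ?_)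
    simp [hF, sub_mul]
  have hFI : Integrable (F * I) μ :=
    hFi.mul_bdd hIm.aestronglyMeasurable (ae_of_all _ hI1)
  have hFX : StronglyMeasurable[predictorAlgebra p] F := by
    have hF' : Measurable fun x : Fin p → ℝ =>
        (G 1 (β ⬝ᵥ x) - G 0 (β ⬝ᵥ x)) * (x j - u j * (β ⬝ᵥ x)) := by
      have hd : Measurable fun x : Fin p → ℝ => β ⬝ᵥ x := by unfold dotProduct; fun_prop
      exact (((hG 1).comp hd).sub ((hG 0).comp hd)).mul
        ((measurable_pi_apply j).sub (hd.const_mul _))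
    exact (hF'.comp (comap_measurable fun z : Obs p => z.1)).stronglyMeasurable
  have e1 : μ[F * I | predictorAlgebra p] =ᵐ[μ] fun z => F z * q (β ⬝ᵥ z.1) := by
    refine (condExp_mul_of_stronglyMeasurable_left hFX hFI hIi).trans ?_
    filter_upwards [hqX] with z hz
    rw [Pi.mul_apply, hz]
  -- No bound on `q` is available; integrability is inherited from the conditional expectation of `F
  -- * I`.
  have hFq : Integrable (fun z => F z * q (β ⬝ᵥ z.1)) μ := integrable_condExp.congr e1
  have e2 : ∫ z, (F * I) z ∂μ = ∫ z, F z * q (β ⬝ᵥ z.1) ∂μ := by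
    rw [← integral_condExp hmXle, integral_congr_ae e1]
  have hKV : K * V = fun z => G 0 (β ⬝ᵥ z.1) * V z + F z * q (β ⬝ᵥ z.1) := by
    funext z
    simp only [Pi.mul_apply, hK, hF]
    ring
  have hKVi : Integrable (K * V) μ := by rw [hKV]; exact hG0.add hFq
  have hKm : StronglyMeasurable[indexAlgebra β] K := by
    have hK' : Measurable fun s : ℝ => G 0 s + (G 1 s - G 0 s) * q s :=
      (hG 0).add (((hG 1).sub (hG 0)).mul hq)
    exact (hK'.comp (comap_measurable fun z : Obs p => β ⬝ᵥ z.1)).stronglyMeasurable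
  have hV0 : μ[V | indexAlgebra β] =ᵐ[μ] 0 := by
    have h1 : StronglyMeasurable[indexAlgebra β] fun z : Obs p => u j * (β ⬝ᵥ z.1) :=
      ((comap_measurable fun z : Obs p => β ⬝ᵥ z.1).const_mul (u j)).stronglyMeasurable
    have h2 := condExp_of_stronglyMeasurable (μ := μ) hmβle h1
      ((integrable_dotProduct hX β).const_mul _)
    have h3 := condExp_sub (μ := μ) (hX j) ((integrable_dotProduct hX β).const_mul (u j))
      (indexAlgebra β)
    rw [h2] at h3
    refine EventuallyEq.trans h3 ?_
    filter_upwards [hu j] with z hz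
    simp [hz]
  have e3 : ∫ z, (K * V) z ∂μ = 0 := by
    have h1 : μ[K * V | indexAlgebra β] =ᵐ[μ] 0 := by
      refine (condExp_mul_of_stronglyMeasurable_left hKm hKVi hVi).trans ?_
      filter_upwards [hV0] with z hz
      simp [hz]
    rw [← integral_condExp hmβle, integral_congr_ae h1]
    simp
  have e4 : (fun z : Obs p => G z.2 (β ⬝ᵥ z.1) * V z) =
      fun z => G 0 (β ⬝ᵥ z.1) * V z + (F * I) z := by
    funext z
    rcases Fin.exists_fin_two.1 ⟨z.2, rfl⟩ with h | h
    · simp [hI, h]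
    · have h' : z.2 = 1 := h
      simp only [Pi.mul_apply, hI, hF, h', Set.indicator, Set.mem_ofPred_eq, if_true]
      ring
  have hi : Integrable (fun z : Obs p => G z.2 (β ⬝ᵥ z.1) * V z) μ := by
    rw [e4]; exact hG0.add hFI
  refine ⟨hi, ?_⟩
  rw [e4, integral_add hG0 hFI, e2, ← integral_add hG0 hFq, ← e3, hKV]

/-- Conditional Jensen in subgradient form: the tangent to the loss at `(b ⬝ᵥ u) βᵀX` lies below the
loss at `bᵀX`, and its linear term is a combination of residuals times a bounded function of `(Y,
βᵀX)`, so it integrates to zero. -/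
lemma risk_projection_le {ρ : ℝ → Fin 2 → ℝ} {L : ℝ≥0}
    (hconv : ∀ y, ConvexOn ℝ Set.univ (fun t => ρ t y))
    (hlip : ∀ y, LipschitzWith L (fun t => ρ t y)) {β u : Fin p → ℝ} {q : ℝ → ℝ}
    (hX : ∀ j, Integrable (fun z : Obs p => z.1 j) μ) (hsemi : IsSemiparametric μ β q)
    (hu : ∀ j,
      μ[fun z : Obs p => z.1 j | indexAlgebra β]
        =ᵐ[μ] fun z => u j * (β ⬝ᵥ z.1)) (b : Fin p → ℝ) :
    risk ρ μ ((b ⬝ᵥ u) • β) ≤ risk ρ μ b := by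
  choose g hgm hgb hg using fun y => (hconv y).exists_measurable_subgradient (hlip y)
  have key := integral_mul_residual_eq_zero hX hsemi hu
    (G := fun y s => g y ((b ⬝ᵥ u) * s)) (fun y => (hgm y).comp (measurable_id.const_mul _))
    (fun y s => hgb y _)
  set W : Fin p → Obs p → ℝ := fun j z =>
    g z.2 ((b ⬝ᵥ u) * (β ⬝ᵥ z.1)) * (z.1 j - u j * (β ⬝ᵥ z.1)) with hW
  have hi : ∀ j ∈ Finset.univ, Integrable (fun z => b j * W j z) μ :=
    fun j _ => (key j).1.const_mul _
  have h0 : ∫ z, ∑ j, b j * W j z ∂μ = 0 := by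
    rw [integral_finsetSum _ hi]
    refine Finset.sum_eq_zero fun j _ => ?_
    rw [integral_const_mul, (key j).2, mul_zero]
  calc risk ρ μ ((b ⬝ᵥ u) • β)
      = ∫ z, (ρ (((b ⬝ᵥ u) • β) ⬝ᵥ z.1) z.2 + ∑ j, b j * W j z) ∂μ := by
        rw [integral_add (integrable_loss hlip hX _) (integrable_finsetSum _ hi), h0, add_zero]
        rfl
    _ ≤ risk ρ μ b := by
        refine integral_mono ((integrable_loss hlip hX _).add (integrable_finsetSum _ hi))
          (integrable_loss hlip hX _) fun z => ?_
        refine le_trans (le_of_eq ?_) (hg z.2 ((b ⬝ᵥ u) * (β ⬝ᵥ z.1)) (b ⬝ᵥ z.1))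
        simp only [smul_dotProduct, smul_eq_mul]
        congr 1
        have : ∑ j, b j * W j z = g z.2 ((b ⬝ᵥ u) * (β ⬝ᵥ z.1)) *
            ∑ j, (b j * z.1 j - b j * u j * (β ⬝ᵥ z.1)) := by
          rw [Finset.mul_sum]
          refine Finset.sum_congr rfl fun j _ => ?_
          simp only [hW]; ring
        rw [this, Finset.sum_sub_distrib, ← Finset.sum_mul]
        rfl

/-- Stationarity along the `j`-th axis reads `E (c Y * X j) = 0`, where `c y` is the derivative of
`ρ · y` at `0`. Since `c Y = c 0 + (c 1 - c 0) Y` and `E X j = 0`, this leaves `(c 1 - c 0) E (Y X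
j) = 0`. -/
lemma covYX_eq_zero_of_isPseudoTrue_zero {ρ : ℝ → Fin 2 → ℝ} {L : ℝ≥0}
    (hlip : ∀ y, LipschitzWith L (fun t => ρ t y))
    (hX : ∀ j, Integrable (fun z : Obs p => z.1 j) μ) (h0 : ∀ j, ∫ z, z.1 j ∂μ = 0)
    (hρ : DistinguishesResponses ρ) (hmin : IsPseudoTrue ρ μ 0) : covYX μ = 0 := by
  obtain ⟨hd0, hd1, hne⟩ := hρ
  have hd : ∀ y, HasDerivAt (fun t => ρ t y) (deriv (fun t => ρ t y) 0) 0 := by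
    intro y
    fin_cases y
    · exact hd0.hasDerivAt
    · exact hd1.hasDerivAt
  funext j
  have hYm : Measurable fun z : Obs p => ((z.2 : ℕ) : ℝ) :=
    (measurable_from_top (f := fun y : Fin 2 => ((y : ℕ) : ℝ))).comp measurable_snd
  have hYX : Integrable (fun z : Obs p => ((z.2 : ℕ) : ℝ) * z.1 j) μ := by
    refine (hX j).bdd_mul (c := 1) hYm.aestronglyMeasurable (ae_of_all _ fun z => ?_)
    have : (z.2 : ℕ) ≤ 1 := by omega
    simpa using this
  have hdm : Measurable fun z : Obs p => deriv (fun t => ρ t z.2) 0 :=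
    (measurable_from_top (f := fun y : Fin 2 => deriv (fun t => ρ t y) 0)).comp measurable_snd
  have hderiv := (hasDerivAt_integral_of_dominated_loc_of_lip (μ := μ) (s := Set.univ) (x₀ := 0)
    (F := fun (t : ℝ) (z : Obs p) => ρ (t * z.1 j) z.2)
    (F' := fun z => deriv (fun t => ρ t z.2) 0 * z.1 j) (bound := fun z => L * |z.1 j|) univ_mem
    (Eventually.of_forall fun t => (measurable_loss hlip (by fun_prop)
      measurable_snd).aestronglyMeasurable)
    (by simpa using integrable_loss hlip hX (0 : Fin p → ℝ))
    (hdm.mul (by fun_prop)).aestronglyMeasurable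
    (ae_of_all _ fun z => by
      refine LipschitzOnWith.of_dist_le_mul fun s _ t _ => ?_
      have h1 := abs_loss_sub_le hlip z.2 (s * z.1 j) (t * z.1 j)
      rw [← sub_mul, abs_mul] at h1
      simp only [Real.dist_eq, Real.coe_nnabs, abs_mul, NNReal.abs_eq, abs_abs]
      linarith)
    ((hX j).abs.const_mul _)
    (ae_of_all _ fun z => by
      have h1 : HasDerivAt (fun t : ℝ => t * z.1 j) (z.1 j) 0 := by
        simpa using (hasDerivAt_id (0 : ℝ)).mul_const (z.1 j)
      have h2 : HasDerivAt (fun t => ρ t z.2) (deriv (fun t => ρ t z.2) 0) (0 * z.1 j) := by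
        rw [zero_mul]; exact hd z.2
      exact h2.comp 0 h1)).2
  have hrisk : ∀ t : ℝ, ∫ z : Obs p, ρ (t * z.1 j) z.2 ∂μ = risk ρ μ (Pi.single j t) := by
    intro t
    unfold risk
    simp [single_dotProduct]
  have hloc : IsLocalMin (fun t : ℝ => ∫ z : Obs p, ρ (t * z.1 j) z.2 ∂μ) 0 := by
    refine Eventually.of_forall fun t => ?_
    simp only [hrisk, Pi.single_zero]
    by_cases h : (Pi.single j t : Fin p → ℝ) = 0
    · rw [h]
    · exact (hmin _ h).le
  have hzero := hloc.hasDerivAt_eq_zero hderiv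
  set c : Fin 2 → ℝ := fun y => deriv (fun t => ρ t y) 0 with hc
  have hsplit : ∀ z : Obs p, c z.2 * z.1 j = c 0 * z.1 j +
      (c 1 - c 0) * (((z.2 : ℕ) : ℝ) * z.1 j) := by
    intro z
    rcases Fin.exists_fin_two.1 ⟨z.2, rfl⟩ with h | h
    · have h' : z.2 = 0 := h
      simp [h']
    · have h' : z.2 = 1 := h
      simp [h']; ring
  have hzero' : ∫ z : Obs p, c z.2 * z.1 j ∂μ = 0 := hzero
  simp only [hsplit] at hzero'
  rw [integral_add ((hX j).const_mul _) (hYX.const_mul _), integral_const_mul, integral_const_mul,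
    h0 j, mul_zero, zero_add] at hzero'
  have hYX0 : ∫ z : Obs p, ((z.2 : ℕ) : ℝ) * z.1 j ∂μ = 0 :=
    (mul_eq_zero.1 hzero').resolve_left (sub_ne_zero.2 hne.symm)
  unfold covYX covariance
  simp only [h0 j, sub_zero, sub_mul]
  rw [integral_sub hYX ((hX j).const_mul _), integral_const_mul, h0 j, hYX0]
  simp

/-- The pseudo-true vector is a multiple of the true parameter. -/
lemma exists_pseudoTrue_eq_smul {ρ : ℝ → Fin 2 → ℝ} {L : ℝ≥0}
    (hconv : ∀ y, ConvexOn ℝ Set.univ (fun t => ρ t y))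
    (hlip : ∀ y, LipschitzWith L (fun t => ρ t y)) {σ : Fin p → ℝ≥0}
    (hsubg : ∀ j, HasSubgaussianMGF (fun z : Obs p => z.1 j) (σ j) μ)
    {β βs : Fin p → ℝ} {q : ℝ → ℝ} (hsemi : IsSemiparametric μ β q)
    (hlin : LinearRegressions μ β) (hβs : IsPseudoTrue ρ μ βs) :
    ∃ η : ℝ, βs = η • β ∧ (DistinguishesResponses ρ → covYX μ ≠ 0 → η ≠ 0) := by
  have hX : ∀ j, Integrable (fun z : Obs p => z.1 j) μ := fun j => (hsubg j).integrable
  have h0 : ∀ j, ∫ z, z.1 j ∂μ = 0 := fun j => (hsubg j).integral_eq_zero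
  obtain ⟨u, hu⟩ := hlin.exists_slope hX h0
  have h1 := risk_projection_le hconv hlip hX hsemi hu βs
  have h2 : βs = (βs ⬝ᵥ u) • β := by
    by_contra hne
    exact absurd (hβs _ (Ne.symm hne)) (not_lt.2 h1)
  refine ⟨βs ⬝ᵥ u, h2, fun hρ hcov hη => hcov ?_⟩
  rw [hη, zero_smul] at h2
  rw [h2] at hβs
  exact covYX_eq_zero_of_isPseudoTrue_zero hlip hX h0 hρ hβs

end PseudoTrue

/-! ### Norms and supports -/

lemma mem_supp {p : ℕ} {b : Fin p → ℝ} {i : Fin p} : i ∈ supp b ↔ b i ≠ 0 := by simp [supp]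

lemma l1norm_smul {p : ℕ} (c : ℝ) (b : Fin p → ℝ) : l1norm (c • b) = |c| * l1norm b := by
  simp [l1norm, abs_mul, Finset.mul_sum]

lemma l2norm_smul {p : ℕ} (c : ℝ) (b : Fin p → ℝ) : l2norm (c • b) = |c| * l2norm b := by
  simp [l2norm, mul_pow, ← Finset.mul_sum, Real.sqrt_mul (sq_nonneg c), Real.sqrt_sq_eq_abs]

lemma abs_le_l1norm {p : ℕ} (b : Fin p → ℝ) (i : Fin p) : |b i| ≤ l1norm b :=
  Finset.single_le_sum (f := fun i => |b i|) (fun _ _ => abs_nonneg _) (Finset.mem_univ i)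

lemma abs_le_l2norm {p : ℕ} (b : Fin p → ℝ) (i : Fin p) : |b i| ≤ l2norm b := by
  refine Real.abs_le_sqrt ?_
  exact Finset.single_le_sum (f := fun i => b i ^ 2) (fun _ _ => sq_nonneg _) (Finset.mem_univ i)

lemma sq_sum_abs_le {p k : ℕ} {w : Finset (Fin p)} (hw : w.card ≤ k) (b : Fin p → ℝ) :
    (∑ i ∈ w, |b i|) ^ 2 ≤ k * ∑ i, b i ^ 2 := by
  have h1 : (∑ i ∈ w, |b i|) ^ 2 ≤ w.card * ∑ i ∈ w, |b i| ^ 2 := sq_sum_le_card_mul_sum_sq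
  have h2 : ∑ i ∈ w, |b i| ^ 2 ≤ ∑ i, b i ^ 2 := by
    simp only [sq_abs]
    exact Finset.sum_le_sum_of_subset_of_nonneg (Finset.subset_univ w) fun _ _ _ => sq_nonneg _
  refine h1.trans (mul_le_mul (by exact_mod_cast hw) h2 ?_ (Nat.cast_nonneg k))
  exact Finset.sum_nonneg fun _ _ => sq_nonneg _

lemma l1norm_le_sqrt_mul_l2norm {p k : ℕ} {w : Finset (Fin p)} (hw : w.card ≤ k) {b : Fin p → ℝ}
    (hb : ∀ i, i ∉ w → b i = 0) : l1norm b ≤ √k * l2norm b := by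
  have h1 : l1norm b = ∑ i ∈ w, |b i| :=
    (Finset.sum_subset (Finset.subset_univ w) fun i _ hi => by simp [hb i hi]).symm
  rw [h1, l2norm, ← Real.sqrt_mul (Nat.cast_nonneg k)]
  exact Real.le_sqrt_of_sq_le (sq_sum_abs_le hw b)

lemma cappedMin_mem {p : ℕ} (b : Fin p → ℝ) :
    ((cappedMin b : ℝ) : EReal) = min (coefMin b) 1 ∧ 0 ≤ cappedMin b := by
  have h0 : (0 : EReal) ≤ min (coefMin b) 1 := by
    refine le_min (le_iInf₂ fun i _ => ?_) zero_le_one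
    exact_mod_cast abs_nonneg (b i)
  have h1 : min (coefMin b) 1 ≤ 1 := min_le_right _ _
  refine ⟨EReal.coe_toReal ?_ ?_, EReal.toReal_nonneg h0⟩
  · exact ne_of_lt (h1.trans_lt (by exact_mod_cast EReal.coe_lt_top 1))
  · exact ne_of_gt (lt_of_lt_of_le (by exact_mod_cast EReal.bot_lt_coe 0) h0)

lemma cappedMin_le_one {p : ℕ} (b : Fin p → ℝ) : cappedMin b ≤ 1 := by
  have : ((cappedMin b : ℝ) : EReal) ≤ 1 := (cappedMin_mem b).1.trans_le (min_le_right _ _)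
  exact_mod_cast this

lemma cappedMin_le_abs {p : ℕ} {b : Fin p → ℝ} {i : Fin p} (hi : i ∈ supp b) :
    cappedMin b ≤ |b i| := by
  have : ((cappedMin b : ℝ) : EReal) ≤ ((|b i| : ℝ) : EReal) :=
    (cappedMin_mem b).1.trans_le ((min_le_left _ _).trans (iInf₂_le i hi))
  exact_mod_cast this

/-! ### Deterministic analysis of the Lasso -/

section Deterministic

variable {ρ : ℝ → Fin 2 → ℝ} {p n : ℕ} {μ : Measure (Obs p)} {b₀ : Fin p → ℝ} {z : Fin n → Obs p}

lemma empRisk_segment_le (hconv : ∀ y, ConvexOn ℝ Set.univ (fun t => ρ t y)) (z : Fin n → Obs p)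
    (b₀ b : Fin p → ℝ) {s : ℝ} (h0 : 0 ≤ s) (h1 : s ≤ 1) :
    empRisk ρ z (b₀ + s • (b - b₀)) - empRisk ρ z b₀ ≤ s * (empRisk ρ z b - empRisk ρ z b₀) := by
  have h : ∀ i, ρ ((b₀ + s • (b - b₀)) ⬝ᵥ (z i).1) (z i).2 ≤
      (1 - s) * ρ (b₀ ⬝ᵥ (z i).1) (z i).2 + s * ρ (b ⬝ᵥ (z i).1) (z i).2 := by
    intro i
    have h2 := (hconv (z i).2).2 (Set.mem_univ (b₀ ⬝ᵥ (z i).1)) (Set.mem_univ (b ⬝ᵥ (z i).1))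
      (sub_nonneg.2 h1) h0 (sub_add_cancel 1 s)
    simp only [smul_eq_mul] at h2
    refine le_trans (le_of_eq ?_) h2
    congr 1
    simp only [add_dotProduct, smul_dotProduct, sub_dotProduct, smul_eq_mul]
    ring
  have h3 := Finset.sum_le_sum fun i (_ : i ∈ Finset.univ) => h i
  rw [Finset.sum_add_distrib, ← Finset.mul_sum, ← Finset.mul_sum] at h3
  have h4 := mul_le_mul_of_nonneg_left h3 (inv_nonneg.2 (Nat.cast_nonneg (α := ℝ) n))
  unfold empRisk
  linarith

/-- The arithmetic of the in-cone case: `A` and `B` are the `ℓ¹` masses of `Δ` on and off the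
support, `Q` is `ΔᵀΔ` and `R` the excess risk. Curvature bounds `A` by a multiple of `k lam`, and `r
≤ (4 + ε) A`. The resulting bound is half the stated one, which makes the inequality strict. -/
lemma cone_radius_lt {A B Q R r lam ε ϑ κ k : ℝ} (hϑ : 0 < ϑ) (hκ : 0 < κ) (hε : 0 < ε)
    (hlam : 0 < lam) (hr : 0 < r) (hk : 0 ≤ k) (hAB : A + B = r) (hcase : r / 4 ≤ (2 + ε) * A)
    (hBA : B ≤ A + r / 4) (hB : 0 ≤ B) (hbasic : R + lam * (B - A) ≤ r * lam / 4)
    (hR : ϑ / 2 * (κ * Q) ≤ R) (hQ : A ^ 2 ≤ k * Q) :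
    r < 4 * (4 + ε) * (3 + ε) / (ϑ * κ) * (k * lam) := by
  have hA : 0 < A := by
    by_contra! h
    nlinarith
  have h4 : R ≤ (3 + ε) * (lam * A) := by
    have h1 := mul_le_mul_of_nonneg_left hcase hlam.le
    have h2 := mul_nonneg hlam.le hB
    linarith
  have h5 : ϑ * κ * A ^ 2 ≤ 2 * (3 + ε) * (k * lam) * A := by
    have h7 := mul_le_mul_of_nonneg_left hQ (mul_pos hϑ hκ).le
    have h8 := mul_le_mul_of_nonneg_left (hR.trans h4) hk
    linarith
  have h6 : ϑ * κ * A ≤ 2 * (3 + ε) * (k * lam) := by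
    refine le_of_mul_le_mul_right ?_ hA
    linarith
  have h7 : A ≤ 2 * (3 + ε) * (k * lam) / (ϑ * κ) := by
    rw [le_div_iff₀ (mul_pos hϑ hκ)]; linarith
  have h8 : r ≤ (4 + ε) * A := by linarith
  have h9 := mul_le_mul_of_nonneg_left h7 (by linarith : 0 ≤ 4 + ε)
  have h10 : 4 * (4 + ε) * (3 + ε) / (ϑ * κ) * (k * lam) =
      2 * ((4 + ε) * (2 * (3 + ε) * (k * lam) / (ϑ * κ))) := by ring
  rw [h10]
  linarith

/-- The localized basic inequality bounds the estimation error of the Lasso. -/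
lemma lasso_error_le (hconv : ∀ y, ConvexOn ℝ Set.univ (fun t => ρ t y))
    (hmin : IsPseudoTrue ρ μ b₀) {H : Matrix (Fin p) (Fin p) ℝ} {ϑ ε₁ δ ε₃ κ : ℝ} (hϑ : 0 < ϑ)
    (hε₁ : 0 < ε₁) (hε₃ : 0 < ε₃) (hκ0 : 0 < κ) (hMC : MarginCondition ρ μ b₀ H ϑ ε₁ δ)
    (hκ : ∀ Δ ∈ cone (supp b₀) ε₃, κ * (Δ ⬝ᵥ Δ) ≤ Δ ⬝ᵥ H.mulVec Δ) {k : ℕ}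
    (hk : (supp b₀).card ≤ k) {lam r : ℝ} (hlam : 0 < lam) (hr : 0 < r) (hrδ : r ≤ δ)
    (hrk : 4 * (4 + min ε₁ ε₃) * (3 + min ε₁ ε₃) / (ϑ * κ) * (k * lam) ≤ r)
    (hz : z ∉ deviationSet ρ μ b₀ r (r * lam / 4)) {bL : Fin p → ℝ}
    (hL : ∀ b', empRisk ρ z bL + lam * l1norm bL ≤ empRisk ρ z b' + lam * l1norm b') :
    l1norm (bL - b₀) ≤ r := by
  by_contra! hd
  set d := l1norm (bL - b₀) with hd_def
  set ε := min ε₁ ε₃ with hε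
  have hε0 : 0 < ε := lt_min hε₁ hε₃
  have hd0 : 0 < d := hr.trans hd
  -- If the error exceeded `r`, the point of the segment from `b₀` to `bL` at `ℓ¹` distance exactly
  -- `r` would still satisfy the basic inequality by convexity; the contradiction is derived there.
  set s := r / d with hs
  have hs0 : 0 < s := div_pos hr hd0
  have hs1 : s ≤ 1 := (div_le_one hd0).2 hd.le
  set Δ := s • (bL - b₀) with hΔ
  have hΔr : l1norm Δ = r := by
    rw [hΔ, l1norm_smul, abs_of_pos hs0, ← hd_def, hs, div_mul_cancel₀ _ hd0.ne']
  have hsub : b₀ + Δ - b₀ = Δ := add_sub_cancel_left _ _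
  have hdev : (risk ρ μ (b₀ + Δ) - risk ρ μ b₀) - (empRisk ρ z (b₀ + Δ) - empRisk ρ z b₀) ≤
      r * lam / 4 := by
    by_contra! h
    exact hz ⟨b₀ + Δ, by rw [hsub, hΔr], h⟩
  have hR : 0 ≤ risk ρ μ (b₀ + Δ) - risk ρ μ b₀ := by
    by_cases h : b₀ + Δ = b₀
    · rw [h, sub_self]
    · exact (sub_pos.2 (hmin _ h)).le
  set A := ∑ i ∈ supp b₀, |Δ i| with hA
  set B := ∑ i ∈ (supp b₀)ᶜ, |Δ i| with hB
  have hAB : A + B = r := by rw [← hΔr, hA, hB, l1norm, Finset.sum_add_sum_compl]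
  have hA0 : 0 ≤ A := Finset.sum_nonneg fun _ _ => abs_nonneg _
  have hB0 : 0 ≤ B := Finset.sum_nonneg fun _ _ => abs_nonneg _
  have hnorm1 : l1norm (b₀ + Δ) ≤ (1 - s) * l1norm b₀ + s * l1norm bL := by
    unfold l1norm
    rw [Finset.mul_sum, Finset.mul_sum, ← Finset.sum_add_distrib]
    refine Finset.sum_le_sum fun i _ => ?_
    have h1 : (b₀ + Δ) i = (1 - s) * b₀ i + s * bL i := by
      simp only [hΔ, Pi.add_apply, Pi.smul_apply, Pi.sub_apply, smul_eq_mul]; ring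
    rw [h1]
    refine (abs_add_le _ _).trans (le_of_eq ?_)
    rw [abs_mul, abs_mul, abs_of_pos hs0, abs_of_nonneg (sub_nonneg.2 hs1)]
  have hnorm2 : B - A ≤ l1norm (b₀ + Δ) - l1norm b₀ := by
    unfold l1norm
    rw [← Finset.sum_add_sum_compl (supp b₀) fun i => |(b₀ + Δ) i|,
      ← Finset.sum_add_sum_compl (supp b₀) fun i => |b₀ i|]
    have h1 : ∑ i ∈ (supp b₀)ᶜ, |b₀ i| = 0 := Finset.sum_eq_zero fun i hi => by
      simpa [mem_supp] using hi
    have h2 : ∑ i ∈ (supp b₀)ᶜ, |(b₀ + Δ) i| = B := Finset.sum_congr rfl fun i hi => by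
      have : b₀ i = 0 := by simpa [mem_supp] using hi
      simp [this]
    have h3 : ∑ i ∈ supp b₀, |b₀ i| ≤ ∑ i ∈ supp b₀, |(b₀ + Δ) i| + A := by
      rw [hA, ← Finset.sum_add_distrib]
      refine Finset.sum_le_sum fun i _ => ?_
      have := abs_sub ((b₀ + Δ) i) (Δ i)
      simpa using this
    linarith
  have hconv' := empRisk_segment_le hconv z b₀ bL hs0.le hs1
  have hopt := mul_le_mul_of_nonneg_left (hL b₀) hs0.le
  have hbasic : (risk ρ μ (b₀ + Δ) - risk ρ μ b₀) + lam * (B - A) ≤ r * lam / 4 := by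
    have h1 := mul_le_mul_of_nonneg_left hnorm1 hlam.le
    have h2 := mul_le_mul_of_nonneg_left hnorm2 hlam.le
    rw [← hΔ] at hconv'
    linarith
  have hBA : B ≤ A + r / 4 := by
    have : lam * B ≤ lam * (A + r / 4) := by linarith
    exact le_of_mul_le_mul_left this hlam
  -- In the first case `B ≤ A + r / 4 ≤ (3 + ε) A`, so `Δ` lies in both cones and curvature applies.
  -- In the second `A < r / 8`, hence `A + B ≤ 2 A + r / 4 < r`, contradicting `A + B = r`.
  rcases le_or_gt (r / 4) ((2 + ε) * A) with hcase | hcase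
  · have hcone : ∀ ε', ε ≤ ε' → Δ ∈ cone (supp b₀) ε' := fun ε' h => by
      change B ≤ (3 + ε') * A
      linarith [mul_le_mul_of_nonneg_right h hA0]
    have h1 := hMC (b₀ + Δ) (by rw [hsub]; exact hcone ε₁ (min_le_left _ _))
      (by rw [hsub, hΔr]; exact hrδ)
    rw [hsub] at h1
    have h2 := hκ Δ (hcone ε₃ (min_le_right _ _))
    have h3 : A ^ 2 ≤ k * (Δ ⬝ᵥ Δ) := by
      have := sq_sum_abs_le hk Δ
      simpa [dotProduct, sq] using this
    exact absurd hrk (not_le.2 (cone_radius_lt hϑ hκ0 hε0 hlam hr (Nat.cast_nonneg k) hAB hcase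
      hBA hB0 hbasic ((mul_le_mul_of_nonneg_left h2 (half_pos hϑ).le).trans h1) h3))
  · linarith [mul_nonneg hε0.le hA0]

/-- If `s` is nonempty it contains the head of the list: otherwise an element of `s` in the tail
would have a value at most that of the head, against the separation. Induction then applies to `s`
without the head. -/
lemma List.exists_take_toFinset_eq {α : Type*} [DecidableEq α] (f : α → ℝ) (l : List α)
    (s : Finset α) (hnd : l.Nodup) (hl : l.Pairwise fun i j => f j ≤ f i) (hs : ∀ i ∈ s, i ∈ l)
    (hsep : ∀ i ∈ s, ∀ j ∈ l, j ∉ s → f j < f i) : ∃ m ≤ l.length, s = (l.take m).toFinset := by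
  induction l generalizing s with
  | nil =>
    refine ⟨0, le_rfl, ?_⟩
    simpa using Finset.eq_empty_of_forall_notMem fun i hi => by simpa using hs i hi
  | cons a l ih =>
    rcases s.eq_empty_or_nonempty with rfl | ⟨i, hi⟩
    · exact ⟨0, by simp, by simp⟩
    rw [List.pairwise_cons] at hl
    rw [List.nodup_cons] at hnd
    have ha : a ∈ s := by
      by_contra ha
      have h1 := hsep i hi a (by simp) ha
      rcases List.mem_cons.1 (hs i hi) with rfl | h
      · exact ha hi
      · exact absurd (hl.1 i h) (not_le.2 h1)
    obtain ⟨m, hm, hsm⟩ := ih (s.erase a) hnd.2 hl.2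
      (fun i hi => by
        rw [Finset.mem_erase] at hi
        exact (List.mem_cons.1 (hs i hi.2)).resolve_left hi.1)
      (fun i hi j hj hjs => by
        refine hsep i (Finset.mem_of_mem_erase hi) j (List.mem_cons_of_mem _ hj) fun hjs' => ?_
        exact hjs (Finset.mem_erase.2 ⟨fun h => hnd.1 (h ▸ hj), hjs'⟩))
    refine ⟨m + 1, by simpa using hm, ?_⟩
    rw [List.take_succ_cons, List.toFinset_cons, ← hsm, Finset.insert_erase ha]

/-- An accurate estimator ranks the true support first. -/
lemma supp_mem_nestedFamily {bL : Fin p → ℝ} {l : List (Fin p)} (hnd : l.Nodup)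
    (hmem : ∀ j, j ∈ l ↔ j ∈ supp bL) (hsort : l.Pairwise fun i j => |bL j| ≤ |bL i|) {r : ℝ}
    (hr : l1norm (bL - b₀) ≤ r) (hmin : ∀ i ∈ supp b₀, 2 * r < |b₀ i|) :
    supp b₀ ∈ nestedFamily l := by
  have hr0 : 0 ≤ r := (l1norm_nonneg _).trans hr
  have hin : ∀ i ∈ supp b₀, r < |bL i| := fun i hi => by
    have h1 := (abs_le_l1norm (bL - b₀) i).trans hr
    have h2 := abs_sub_abs_le_abs_sub (b₀ i) (bL i)
    rw [abs_sub_comm] at h2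
    have h3 := hmin i hi
    simp only [Pi.sub_apply] at h1
    linarith
  refine List.exists_take_toFinset_eq (fun i => |bL i|) l (supp b₀) hnd hsort (fun i hi => ?_)
    fun i hi j _ hj => ?_
  · rw [hmem, mem_supp, ← abs_pos]
    exact hr0.trans_lt (hin i hi)
  · have h1 := (abs_le_l1norm (bL - b₀) j).trans hr
    have h2 : b₀ j = 0 := by simpa [mem_supp] using hj
    simp only [Pi.sub_apply, h2, sub_zero] at h1
    exact h1.trans_lt (hin i hi)

lemma nestedFamily_total {l : List (Fin p)} {v w : Finset (Fin p)} (hv : v ∈ nestedFamily l)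
    (hw : w ∈ nestedFamily l) : v ⊆ w ∨ w ⊆ v := by
  obtain ⟨m, _, rfl⟩ := hv
  obtain ⟨m', _, rfl⟩ := hw
  have h : ∀ a b, a ≤ b → (l.take a).toFinset ⊆ (l.take b).toFinset := fun a b hab i hi => by
    rw [List.mem_toFinset] at hi ⊢
    exact (List.take_subset_take_left l hab) hi
  exact (le_total m m').imp (h _ _) (h _ _)

/-! ### Deterministic analysis of the selection step -/

/-- Growth of the empirical risk over a model that contains the support of the pseudo-true
vector. -/
lemma empRisk_growth (hconv : ∀ y, ConvexOn ℝ Set.univ (fun t => ρ t y)) {w : Finset (Fin p)}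
    {k : ℕ} {θ ε₂ r : ℝ} (hw : w.card ≤ k) (hsw : supp b₀ ⊆ w) (hθ : 0 < θ)
    (hC : ModelMarginCondition ρ μ b₀ θ ε₂ w) (hr : 0 < r) (hrε : r ≤ ε₂)
    (hz : z ∉ deviationSet ρ μ b₀ (√k * r) (θ * r ^ 2 / 2)) {b : Fin p → ℝ} (hb : supp b ⊆ w) :
    -(θ * r ^ 2 / 2) ≤ empRisk ρ z b - empRisk ρ z b₀ ∧
      (r ≤ l2norm (b - b₀) → θ * r ^ 2 / 2 ≤ empRisk ρ z b - empRisk ρ z b₀) := by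
  have hvanish : ∀ b' : Fin p → ℝ, supp b' ⊆ w → ∀ i, i ∉ w → b' i = 0 := fun b' hb' i hi => by
    by_contra h
    exact hi (hb' (mem_supp.2 h))
  have hball : ∀ b', supp b' ⊆ w → l2norm (b' - b₀) ≤ r →
      θ * l2norm (b' - b₀) ^ 2 - θ * r ^ 2 / 2 ≤ empRisk ρ z b' - empRisk ρ z b₀ := by
    intro b' hb' hr'
    have h1 := hC b' hb' (hr'.trans hrε)
    have h2 : l1norm (b' - b₀) ≤ √k * r :=
      (l1norm_le_sqrt_mul_l2norm hw fun i hi => by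
        simp [hvanish b' hb' i hi, hvanish b₀ hsw i hi]).trans
        (mul_le_mul_of_nonneg_left hr' (Real.sqrt_nonneg _))
    by_contra! h
    exact hz ⟨b', h2, by linarith⟩
  -- A distant `b` is pulled back to the sphere of radius `r`, where the margin `θ r²` outweighs the
  -- deviation `θ r² / 2`; by convexity the growth at `b` itself is at least as large.
  have hout : r ≤ l2norm (b - b₀) → θ * r ^ 2 / 2 ≤ empRisk ρ z b - empRisk ρ z b₀ := by
    intro hrb
    have hd : 0 < l2norm (b - b₀) := hr.trans_le hrb
    set s := r / l2norm (b - b₀) with hs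
    have hs0 : 0 < s := div_pos hr hd
    have hs1 : s ≤ 1 := (div_le_one hd).2 hrb
    have hn : l2norm (b₀ + s • (b - b₀) - b₀) = r := by
      rw [add_sub_cancel_left, l2norm_smul, abs_of_pos hs0, hs, div_mul_cancel₀ _ hd.ne']
    have hsupp : supp (b₀ + s • (b - b₀)) ⊆ w := fun i hi => by
      by_contra h
      rw [mem_supp] at hi
      exact hi (by simp [hvanish b hb i h, hvanish b₀ hsw i h])
    have h1 := hball _ hsupp hn.le
    rw [hn] at h1
    have h2 := h1.trans (empRisk_segment_le hconv z b₀ b hs0.le hs1)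
    have h3 : 0 < θ * r ^ 2 := by positivity
    have h4 : 0 < empRisk ρ z b - empRisk ρ z b₀ := by
      by_contra! h
      have := mul_nonpos_of_nonneg_of_nonpos hs0.le h
      linarith
    have h5 := mul_le_mul_of_nonneg_right hs1 h4.le
    linarith
  refine ⟨?_, hout⟩
  rcases le_total (l2norm (b - b₀)) r with h | h
  · have h1 := hball b hb h
    have h2 : 0 ≤ θ * l2norm (b - b₀) ^ 2 := by positivity
    linarith
  · have h1 := hout h
    have h2 : 0 ≤ θ * r ^ 2 := by positivity
    linarith

lemma gic_supp_le (ρ : ℝ → Fin 2 → ℝ) (a : ℝ) (z : Fin n → Obs p) (b₀ : Fin p → ℝ) :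
    gic ρ a z (supp b₀) ≤ ((n * empRisk ρ z b₀ + a * (supp b₀).card : ℝ) : EReal) := by
  rw [EReal.coe_add]
  exact add_le_add_left (iInf₂_le b₀ (Finset.Subset.refl _)) _

lemma le_gic {a c : ℝ} {w : Finset (Fin p)}
    (h : ∀ b, supp b ⊆ w → c ≤ empRisk ρ z b) :
    ((n * c + a * w.card : ℝ) : EReal) ≤ gic ρ a z w := by
  rw [EReal.coe_add]
  refine add_le_add_left (le_iInf₂ fun b hb => EReal.coe_le_coe_iff.2 ?_) _
  exact mul_le_mul_of_nonneg_left (h b hb) (Nat.cast_nonneg n)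

/-- The selection step is consistent off the deviation events. -/
lemma selected_eq_supp (hconv : ∀ y, ConvexOn ℝ Set.univ (fun t => ρ t y)) {k : ℕ} {θ ε₂ a : ℝ}
    (hθ : 0 < θ) (ha : 0 < a)
    (hC : ∀ w : Finset (Fin p), w.card ≤ k → ModelMarginCondition ρ μ b₀ θ ε₂ w)
    (hk : (supp b₀).card ≤ k) {l : List (Fin p)} {s : Finset (Fin p)}
    (hfam : ∀ w ∈ nestedFamily l, w.card ≤ k) (hmem : supp b₀ ∈ nestedFamily l)
    (hs : s ∈ nestedFamily l) (hgic : ∀ w ∈ nestedFamily l, gic ρ a z s ≤ gic ρ a z w)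
    {r₁ r₂ : ℝ} (hr₁ : 0 < r₁) (hr₁ε : r₁ ≤ ε₂) (hr₁a : n * (θ * r₁ ^ 2 / 2) < a)
    (hz₁ : z ∉ deviationSet ρ μ b₀ (√k * r₁) (θ * r₁ ^ 2 / 2))
    (hr₂ : 0 < r₂) (hr₂ε : r₂ ≤ ε₂) (hr₂m : r₂ ≤ cappedMin b₀)
    (hr₂a : a * k < n * (θ * r₂ ^ 2 / 2))
    (hz₂ : z ∉ deviationSet ρ μ b₀ (√k * r₂) (θ * r₂ ^ 2 / 2)) : s = supp b₀ := by
  by_contra hne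
  have hle := (hgic _ hmem).trans (gic_supp_le ρ a z b₀)
  rcases nestedFamily_total hs hmem with h | h
  -- Underfitting: missing an index `i` keeps each candidate at distance at least `|b₀ i| ≥ r₂`, so
  -- the fit worsens by more than `a k`, which exceeds any saving in the penalty.
  · have hss : s ⊂ supp b₀ := lt_of_le_of_ne h hne
    obtain ⟨i, hi, his⟩ := Finset.exists_of_ssubset hss
    have h1 := (le_gic (a := a) (w := s) (c := empRisk ρ z b₀ + θ * r₂ ^ 2 / 2) fun b hb => by
      have hbi : b i = 0 := by
        by_contra h'
        exact his (hb (mem_supp.2 h'))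
      have h2 := abs_le_l2norm (b - b₀) i
      rw [Pi.sub_apply, hbi, zero_sub, abs_neg] at h2
      have h3 := (empRisk_growth hconv hk (Finset.Subset.refl _) hθ (hC _ hk) hr₂ hr₂ε hz₂
        (hb.trans h)).2 (hr₂m.trans ((cappedMin_le_abs hi).trans h2))
      linarith).trans hle
    rw [EReal.coe_le_coe_iff] at h1
    have h4 : (((supp b₀).card : ℕ) : ℝ) ≤ k := by exact_mod_cast hk
    have h5 := mul_le_mul_of_nonneg_left h4 ha.le
    have h6 : 0 ≤ a * (s.card : ℝ) := by positivity
    linarith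
  -- Overfitting: the fit improves by at most `n θ r₁² / 2 < a`, less than the penalty of one extra
  -- index.
  · have hss : supp b₀ ⊂ s := lt_of_le_of_ne h (Ne.symm hne)
    have h1 := (le_gic (a := a) (w := s) (c := empRisk ρ z b₀ - θ * r₁ ^ 2 / 2) fun b hb => by
      have h3 := (empRisk_growth hconv (hfam s hs) h hθ (hC _ (hfam s hs)) hr₁ hr₁ε hz₁ hb).1
      linarith).trans hle
    rw [EReal.coe_le_coe_iff] at h1
    have h4 : (((supp b₀).card : ℕ) : ℝ) + 1 ≤ (s.card : ℝ) := by
      exact_mod_cast Finset.card_lt_card hss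
    have h5 := mul_le_mul_of_nonneg_left h4 ha.le
    linarith

end Deterministic

/-! ### Asymptotics -/

lemma supp_smul_of_ne_zero {p : ℕ} {η : ℝ} (hη : η ≠ 0) (b : Fin p → ℝ) :
    supp (η • b) = supp b := by
  ext i
  simp [mem_supp, hη]

lemma mul_dotProduct_le_of_lt_kappa {p : ℕ} {H : Matrix (Fin p) (Fin p) ℝ} {s : Finset (Fin p)}
    {ε κ : ℝ} (h : (κ : EReal) < kappa H s ε) :
    ∀ Δ ∈ cone s ε, κ * (Δ ⬝ᵥ Δ) ≤ Δ ⬝ᵥ H.mulVec Δ := by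
  intro Δ hΔ
  by_cases h0 : Δ = 0
  · simp [h0]
  have h1 : (κ : EReal) ≤ (((Δ ⬝ᵥ H.mulVec Δ) / (Δ ⬝ᵥ Δ) : ℝ) : EReal) :=
    h.le.trans (iInf₂_le Δ ⟨hΔ, h0⟩)
  have h2 : 0 < Δ ⬝ᵥ Δ := by
    refine lt_of_le_of_ne ?_ fun h => h0 (dotProduct_self_eq_zero.1 h.symm)
    exact Finset.sum_nonneg fun i _ => mul_self_nonneg _
  exact (le_div_iff₀ h2).1 (EReal.coe_le_coe_iff.1 h1)

/-- The deviation set need not be measurable, so only the inequality between the measure of a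
preimage and the image measure is used. -/
lemma measure_deviationSet_preimage_le {ρ : ℝ → Fin 2 → ℝ} {L : ℝ≥0} {p n : ℕ} (hn : 0 < n)
    {μ : Measure (Obs p)} [IsProbabilityMeasure μ]
    (hlip : ∀ y, LipschitzWith L (fun t => ρ t y)) {c : Fin p → ℝ≥0} {S : ℝ≥0}
    (h : ∀ j, HasSubgaussianMGF (fun z : Obs p => z.1 j) (c j) μ) (hc : ∀ j, c j ≤ S)
    {Ω : Type*} [MeasurableSpace Ω] {P : Measure Ω} {Z : Fin n → Ω → Obs p}
    (hlaw : ∀ i, HasLaw (Z i) μ P) (hindep : iIndepFun Z P)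
    (b₀ : Fin p → ℝ) {t τ : ℝ} (hτ : 0 < τ) (ht : 0 ≤ t) :
    P {ω | (fun i => Z i ω) ∈ deviationSet ρ μ b₀ t τ} ≤
      ENNReal.ofReal (2 * L * (5 + S / 2) * (t * √(logDim p / n) / τ)) := by
  have hZ := hindep.hasLaw_pi hlaw
  refine (Measure.le_map_apply hZ.aemeasurable (deviationSet ρ μ b₀ t τ)).trans ?_
  rw [hZ.map_eq]
  exact measure_deviationSet_le hn hlip h hc b₀ hτ ht

lemma tendsto_const_mul_sqrt_zero {f : ℕ → ℝ} (hf : Tendsto f atTop (𝓝 0)) (C : ℝ) :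
    Tendsto (fun n => C * √(f n)) atTop (𝓝 0) := by
  have := ((Real.continuous_sqrt.tendsto 0).comp hf).const_mul C
  simpa using this

/-- The rate in the selection step. -/
lemma sqrt_mul_deviation_eq {k l x θ r : ℝ} (hk : 0 ≤ k) (hx : 0 < x) (hθ : 0 < θ)
    (hr : 0 < r) :
    √k * r * √(l / x) / (θ * r ^ 2 / 2) = 2 / θ * √(k * l / (x * r ^ 2)) := by
  have h1 : √(k * l / (x * r ^ 2)) = √k * √(l / x) / r := by
    rw [show k * l / (x * r ^ 2) = k * (l / x) / r ^ 2 by field_simp,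
      Real.sqrt_div' _ (sq_nonneg r), Real.sqrt_sq hr.le, Real.sqrt_mul hk]
  rw [h1]
  field_simp

lemma tendsto_measure_of_subset_union {Ω : ℕ → Type*} [∀ n, MeasurableSpace (Ω n)]
    {P : ∀ n, Measure (Ω n)} [∀ n, IsProbabilityMeasure (P n)] {A G : ∀ n, Set (Ω n)}
    {x : ℕ → ℝ≥0∞} (hA : Tendsto (fun n => P n (A n)) atTop (𝓝 1)) (hx : Tendsto x atTop (𝓝 0))
    (h : ∀ᶠ n in atTop, P n (A n) ≤ P n (G n) + x n) :
    Tendsto (fun n => P n (G n)) atTop (𝓝 1) := by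
  have h1 : Tendsto (fun n => P n (A n) - x n) atTop (𝓝 1) := by
    simpa using ENNReal.Tendsto.sub hA hx (Or.inl ENNReal.one_ne_top)
  refine tendsto_of_tendsto_of_tendsto_of_le_of_le' h1 tendsto_const_nhds ?_
    (Eventually.of_forall fun n => prob_le_one)
  filter_upwards [h] with n hn
  exact tsub_le_iff_right.2 hn

theorem corollary5
    -- the loss
    (ρ : ℝ → Fin 2 → ℝ) (L : ℝ≥0)
    (hconv : ∀ y, ConvexOn ℝ Set.univ (fun t => ρ t y))
    (hlip : ∀ y, LipschitzWith L (fun t => ρ t y))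
    -- the law of one observation at stage `n`
    (p : ℕ → ℕ) (μ : ∀ n, Measure (Obs (p n))) [∀ n, IsProbabilityMeasure (μ n)]
    -- subgaussian predictors
    (σ : ∀ n, Fin (p n) → ℝ≥0)
    (hsubg : ∀ n j, HasSubgaussianMGF (fun z : Obs (p n) => z.1 j) (σ n j ^ 2) (μ n))
    (hσ : limsup (fun n => ⨆ j, ((σ n j ^ 2 : ℝ≥0) : ℝ≥0∞)) atTop < ⊤)
    -- the semiparametric model with true parameter `β` and the linear regressions condition
    (β : ∀ n, Fin (p n) → ℝ) (q : ℕ → ℝ → ℝ)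
    (hsemi : ∀ n, IsSemiparametric (μ n) (β n) (q n))
    (hlin : ∀ n, LinearRegressions (μ n) (β n))
    -- existence and uniqueness of the pseudo-true vector `β*`
    (βs : ∀ n, Fin (p n) → ℝ)
    (hβs : ∀ n, IsPseudoTrue ρ (μ n) (βs n))
    -- the margin conditions
    (H : ∀ n, Matrix (Fin (p n)) (Fin (p n)) ℝ) (hH : ∀ n, (H n).PosSemidef)
    (ϑ ε₁ δ : ℝ) (hϑ : 0 < ϑ) (hε₁ : 0 < ε₁) (hδ : 0 < δ)
    (hMC : ∀ n, MarginCondition ρ (μ n) (βs n) (H n) ϑ ε₁ δ)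
    (k : ℕ → ℕ) (hk : ∀ n, 1 ≤ k n)
    (θ ε₂ : ℝ) (hθ : 0 < θ) (hε₂ : 0 < ε₂)
    (hC : ∀ n, ∀ w : Finset (Fin (p n)), w.card ≤ k n →
      ModelMarginCondition ρ (μ n) (βs n) θ ε₂ w)
    -- the i.i.d. samples of size `n`
    {Ω : ℕ → Type*} [∀ n, MeasurableSpace (Ω n)] (P : ∀ n, Measure (Ω n))
    [∀ n, IsProbabilityMeasure (P n)]
    (Z : ∀ n, Fin n → Ω n → Obs (p n))
    (hlaw : ∀ n i, HasLaw (Z n i) (μ n) (P n))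
    (hindep : ∀ n, iIndepFun (Z n) (P n))
    -- the screening and selection procedure
    (lam a : ℕ → ℝ) (hlam : ∀ n, 0 < lam n) (ha : ∀ n, 0 < a n)
    (bL : ∀ n, Ω n → Fin (p n) → ℝ) (hbL : ∀ n, Measurable (bL n))
    (ord : ∀ n, Ω n → List (Fin (p n)))
    (sHat : ∀ n, Ω n → Finset (Fin (p n)))
    (hsHat : ∀ n w, MeasurableSet {ω | sHat n ω = w})
    (hrun : ∀ n, ∀ᵐ ω ∂(P n),
      IsSSRun ρ (lam n) (a n) (fun i => Z n i ω) (bL n ω) (ord n ω) (sHat n ω))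
    -- the asymptotic conditions
    (hcard : ∀ n, (supp (βs n)).card ≤ k n)
    (hfam : Tendsto (fun n => P n {ω | ∀ w ∈ nestedFamily (ord n ω), w.card ≤ k n}) atTop (𝓝 1))
    (ε₃ : ℝ) (hε₃ : 0 < ε₃)
    (hkappa : 0 < liminf (fun n => kappa (H n) (supp (βs n)) ε₃) atTop)
    (has₁ : (fun n => Real.log (max (p n : ℝ) 2)) =o[atTop] fun n => (n : ℝ) * lam n ^ 2)
    (has₂ : (fun n => (k n : ℝ) * lam n) =o[atTop] fun n => cappedMin (βs n))
    (has₃ : (fun n => (k n : ℝ) * Real.log (max (p n : ℝ) 2)) =o[atTop] fun n => (n : ℝ))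
    (has₄ : (fun n => (k n : ℝ) * Real.log (max (p n : ℝ) 2)) =o[atTop] a)
    (has₅ : (fun n => a n * (k n : ℝ)) =o[atTop] fun n => (n : ℝ) * cappedMin (βs n) ^ 2) :
    (∀ n, ∃ η : ℝ, βs n = η • β n ∧
      (DistinguishesResponses ρ → covYX (μ n) ≠ 0 → η ≠ 0)) ∧
    ((∀ᶠ n in atTop, β n ≠ 0 →
        βs n ≠ 0 ∨ (DistinguishesResponses ρ ∧ covYX (μ n) ≠ 0)) →
      Tendsto (fun n => P n {ω | sHat n ω = supp (β n)}) atTop (𝓝 1)) := by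

  have hprop : ∀ n, ∃ η : ℝ, βs n = η • β n ∧
      (DistinguishesResponses ρ → covYX (μ n) ≠ 0 → η ≠ 0) := fun n =>
    exists_pseudoTrue_eq_smul hconv hlip (hsubg n) (hsemi n) (hlin n) (hβs n)
  refine ⟨hprop, fun hne => ?_⟩
  have hsupp : ∀ᶠ n in atTop, supp (βs n) = supp (β n) := by
    filter_upwards [hne] with n hn
    obtain ⟨η, hη, hη'⟩ := hprop n
    by_cases hβ : β n = 0
    · rw [hη, hβ, smul_zero]
    · have : η ≠ 0 := by
        rcases hn hβ with h | ⟨h, h'⟩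
        · rintro rfl
          exact h (by simpa using hη)
        · exact hη' h h'
      rw [hη, supp_smul_of_ne_zero this]
  obtain ⟨S, hS, -⟩ := ENNReal.lt_iff_exists_nnreal_btwn.1 hσ
  have hS' : ∀ᶠ n in atTop, ∀ j, σ n j ^ 2 ≤ S := by
    filter_upwards [eventually_lt_of_limsup_lt hS] with n hn j
    exact ENNReal.coe_le_coe.1 ((le_iSup (fun j => ((σ n j ^ 2 : ℝ≥0) : ℝ≥0∞)) j).trans hn.le)
  obtain ⟨κ, hκ0, hκ⟩ := EReal.lt_iff_exists_real_btwn.1 hkappa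
  have hκ0' : 0 < κ := by exact_mod_cast hκ0
  have hκ' := eventually_lt_of_lt_liminf hκ
  set ε := min ε₁ ε₃ with hε
  have hε0 : 0 < ε := lt_min hε₁ hε₃
  set C := 4 * (4 + ε) * (3 + ε) / (ϑ * κ) with hC_def
  have hC0 : 0 < C := by positivity
  set c := min ε₂ 1 with hc_def
  have hc0 : 0 < c := lt_min hε₂ one_pos
  set m : ℕ → ℝ := fun n => cappedMin (βs n) with hm_def
  have hk1 : ∀ n, (1 : ℝ) ≤ k n := fun n => by exact_mod_cast hk n
  -- Positivity is read off from `k λ = o(m)`, as `k λ > 0`.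
  have hm0 : ∀ᶠ n in atTop, 0 < m n := by
    filter_upwards [has₂.bound one_pos] with n hn
    rw [Real.norm_eq_abs, Real.norm_eq_abs, one_mul, abs_of_nonneg (cappedMin_mem (βs n)).2,
      abs_of_pos (mul_pos (by linarith [hk1 n]) (hlam n))] at hn
    exact (mul_pos (by linarith [hk1 n]) (hlam n)).trans_le hn
  have hm1 : ∀ n, m n ≤ 1 := fun n => cappedMin_le_one _
  have hratio : Tendsto (fun n => a n * k n / (n * m n ^ 2)) atTop (𝓝 0) :=
    has₅.tendsto_div_nhds_zero
  have hratio' : Tendsto (fun n => k n * logDim (p n) / a n) atTop (𝓝 0) :=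
    has₄.tendsto_div_nhds_zero
  set r : ℕ → ℝ := fun n => C * (k n * lam n) with hr_def
  -- This radius makes `n θ r₁² / 2` equal to `a / 2`, below one unit of penalty. The factor `c` in
  -- `r₂` keeps that radius below both `ε₂` and `m`.
  set r₁ : ℕ → ℝ := fun n => √(a n / (θ * n)) with hr₁_def
  set r₂ : ℕ → ℝ := fun n => c * m n with hr₂_def
  have hr0 : ∀ n, 0 < r n := fun n =>
    mul_pos hC0 (mul_pos (by linarith [hk1 n]) (hlam n))
  have hr : ∀ᶠ n in atTop, r n ≤ δ ∧ 2 * r n < m n := by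
    have hc1 : 0 < min δ (1 / 4) / C := by positivity
    filter_upwards [has₂.bound hc1, hm0] with n hn hmn
    rw [Real.norm_eq_abs, Real.norm_eq_abs, abs_of_nonneg (cappedMin_mem (βs n)).2,
      abs_of_pos (mul_pos (by linarith [hk1 n]) (hlam n)), div_mul_eq_mul_div,
      le_div_iff₀ hC0, mul_comm] at hn
    have h1 : min δ (1 / 4) * m n ≤ δ * 1 :=
      mul_le_mul (min_le_left _ _) (hm1 n) hmn.le hδ.le
    have h2 : min δ (1 / 4) * m n ≤ 1 / 4 * m n :=
      mul_le_mul_of_nonneg_right (min_le_right _ _) hmn.le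
    constructor <;> simp only [hr_def] <;> linarith
  have hak : ∀ᶠ n in atTop, a n / (n * m n ^ 2) ≤ θ * ε₂ ^ 2 ∧
      a n * k n / (n * m n ^ 2) < θ * c ^ 2 / 2 := by
    filter_upwards [hratio.eventually_lt_const (by positivity : 0 < θ * ε₂ ^ 2),
      hratio.eventually_lt_const (by positivity : 0 < θ * c ^ 2 / 2)] with n h1 h2
    refine ⟨le_trans ?_ h1.le, h2⟩
    gcongr
    exact le_mul_of_one_le_right (ha n).le (hk1 n)
  set D : ℝ := 2 * L * (5 + S / 2) with hD_def
  have hx₁ : Tendsto (fun n => ENNReal.ofReal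
      (D * 4 * √(logDim (p n) / (n * lam n ^ 2)))) atTop (𝓝 0) := by
    rw [← ENNReal.ofReal_zero]
    exact ENNReal.tendsto_ofReal (tendsto_const_mul_sqrt_zero has₁.tendsto_div_nhds_zero _)
  have hx₂ : Tendsto (fun n => ENNReal.ofReal
      (D * (2 / θ) * √(θ * (k n * logDim (p n) / a n)))) atTop (𝓝 0) := by
    rw [← ENNReal.ofReal_zero]
    refine ENNReal.tendsto_ofReal (tendsto_const_mul_sqrt_zero ?_ _)
    simpa using hratio'.const_mul θ
  -- The rate `k log p / (n m²)` of the third event is bounded, using `k ≥ 1`, by the product of the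
  -- two vanishing ratios `k log p / a` and `a k / (n m²)`.
  have hx₃ : Tendsto (fun n => ENNReal.ofReal
      (D * (2 / θ) * √((c ^ 2)⁻¹ * (k n * logDim (p n) / a n * (a n * k n / (n * m n ^ 2))))))
      atTop (𝓝 0) := by
    rw [← ENNReal.ofReal_zero]
    refine ENNReal.tendsto_ofReal (tendsto_const_mul_sqrt_zero ?_ _)
    simpa using (hratio'.mul hratio).const_mul (c ^ 2)⁻¹
  have hx := (hx₁.add hx₂).add hx₃
  simp only [add_zero] at hx
  refine tendsto_measure_of_subset_union hfam hx ?_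
  filter_upwards [hsupp, hS', hκ', hm0, hr, hak, eventually_gt_atTop 0] with
    n hsuppn hSn hκn hmn hrn hakn hn
  have hn' : (0 : ℝ) < n := Nat.cast_pos.2 hn
  have hl : 0 < logDim (p n) := logDim_pos _
  have han := ha n
  have hln := hlam n
  have hkn : (0 : ℝ) < k n := one_pos.trans_le (hk1 n)
  have hr₁0 : 0 < r₁ n := Real.sqrt_pos.2 (by positivity)
  have hr₁sq : r₁ n ^ 2 = a n / (θ * n) := Real.sq_sqrt (by positivity)
  have hr₁ε : r₁ n ≤ ε₂ := by
    refine (Real.sqrt_le_left hε₂.le).2 ?_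
    have h1 := hakn.1
    rw [div_le_iff₀ (by positivity)] at h1 ⊢
    have h2 : m n ^ 2 ≤ 1 := pow_le_one₀ hmn.le (hm1 n)
    have h3 : θ * ε₂ ^ 2 * (n * m n ^ 2) ≤ θ * ε₂ ^ 2 * (n * 1) := by gcongr
    linarith
  have hr₂0 : 0 < r₂ n := mul_pos hc0 hmn
  have hr₂ε : r₂ n ≤ ε₂ := by
    have := mul_le_mul (min_le_left ε₂ 1) (hm1 n) hmn.le hε₂.le
    simpa [hr₂_def, hc_def] using this
  have hr₂m : r₂ n ≤ m n := mul_le_of_le_one_left hmn.le (min_le_right _ _)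
  have hτ : ∀ {x : ℝ}, 0 < x → 0 < θ * x ^ 2 / 2 := fun h => by positivity
  have hdev : ∀ {t τ : ℝ}, 0 < τ → 0 ≤ t →
      P n {ω | (fun i => Z n i ω) ∈ deviationSet ρ (μ n) (βs n) t τ} ≤
        ENNReal.ofReal (D * (t * √(logDim (p n) / n) / τ)) := fun hτ ht =>
    measure_deviationSet_preimage_le hn hlip (hsubg n) hSn (hlaw n) (hindep n) (βs n) hτ ht
  have hd₁ := hdev (t := r n) (τ := r n * lam n / 4) (by have := hr0 n; positivity) (hr0 n).le
  have hd₂ := hdev (t := √(k n) * r₁ n) (hτ hr₁0) (by positivity)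
  have hd₃ := hdev (t := √(k n) * r₂ n) (hτ hr₂0) (by positivity)
  rw [sqrt_mul_deviation_eq hkn.le hn' hθ hr₁0, ← mul_assoc D,
    show k n * logDim (p n) / (n * r₁ n ^ 2) = θ * (k n * logDim (p n) / a n) by
      rw [hr₁sq]; field_simp] at hd₂
  rw [sqrt_mul_deviation_eq hkn.le hn' hθ hr₂0, ← mul_assoc D] at hd₃
  replace hd₃ := hd₃.trans (ENNReal.ofReal_le_ofReal (mul_le_mul_of_nonneg_left
    (Real.sqrt_le_sqrt (show k n * logDim (p n) / (n * r₂ n ^ 2) ≤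
      (c ^ 2)⁻¹ * (k n * logDim (p n) / a n * (a n * k n / (n * m n ^ 2))) by
        rw [show (c ^ 2)⁻¹ * (k n * logDim (p n) / a n * (a n * k n / (n * m n ^ 2))) =
          k n * logDim (p n) / (n * r₂ n ^ 2) * k n by simp only [hr₂_def]; field_simp]
        exact le_mul_of_one_le_right (by positivity) (hk1 n))) (by positivity)))
  rw [show r n * √(logDim (p n) / n) / (r n * lam n / 4) =
      4 * √(logDim (p n) / (n * lam n ^ 2)) by
    rw [← div_div, Real.sqrt_div' _ (sq_nonneg (lam n)), Real.sqrt_sq hln.le]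
    have := (hr0 n).ne'
    field_simp, ← mul_assoc D] at hd₁
  set B₁ := {ω | (fun i => Z n i ω) ∈ deviationSet ρ (μ n) (βs n) (r n) (r n * lam n / 4)}
  set B₂ := {ω | (fun i => Z n i ω) ∈
    deviationSet ρ (μ n) (βs n) (√(k n) * r₁ n) (θ * r₁ n ^ 2 / 2)}
  set B₃ := {ω | (fun i => Z n i ω) ∈
    deviationSet ρ (μ n) (βs n) (√(k n) * r₂ n) (θ * r₂ n ^ 2 / 2)}
  have hsub : {ω | ∀ w ∈ nestedFamily (ord n ω), w.card ≤ k n} ≤ᵐ[P n]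
      ({ω | sHat n ω = supp (β n)} ∪ (B₁ ∪ B₂ ∪ B₃) : Set (Ω n)) := by
    filter_upwards [hrun n] with ω hω hfamω
    by_cases hB : ω ∈ B₁ ∪ B₂ ∪ B₃
    · exact Or.inr hB
    refine Or.inl ?_
    have hB' : ω ∉ B₁ ∧ ω ∉ B₂ ∧ ω ∉ B₃ :=
      ⟨fun h => hB (Or.inl (Or.inl h)), fun h => hB (Or.inl (Or.inr h)), fun h => hB (Or.inr h)⟩
    have hlasso := lasso_error_le hconv (hβs n) hϑ hε₁ hε₃ hκ0' (hMC n)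
      (mul_dotProduct_le_of_lt_kappa hκn) (hcard n) hln (hr0 n) hrn.1 le_rfl hB'.1 hω.lasso
    have hmem := supp_mem_nestedFamily hω.nodup hω.mem_iff hω.sorted hlasso
      fun i hi => hrn.2.trans_le (cappedMin_le_abs hi)
    change sHat n ω = supp (β n)
    rw [← hsuppn]
    refine selected_eq_supp hconv hθ han (hC n) (hcard n) hfamω hmem hω.selected_mem
      hω.selected_min hr₁0 hr₁ε ?_ hB'.2.1 hr₂0 hr₂ε hr₂m ?_ hB'.2.2
    · rw [hr₁sq, show (n : ℝ) * (θ * (a n / (θ * n)) / 2) = a n / 2 by field_simp]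
      linarith
    · have h1 := hakn.2
      rw [div_lt_iff₀ (by positivity)] at h1
      refine h1.trans_le (le_of_eq ?_)
      simp only [hr₂_def]
      ring
  calc P n {ω | ∀ w ∈ nestedFamily (ord n ω), w.card ≤ k n}
      ≤ P n ({ω | sHat n ω = supp (β n)} ∪ (B₁ ∪ B₂ ∪ B₃)) := measure_mono_ae hsub
    _ ≤ P n {ω | sHat n ω = supp (β n)} + (P n B₁ + P n B₂ + P n B₃) := by
        refine (measure_union_le _ _).trans (add_le_add_right ?_ _)
        exact (measure_union_le _ _).trans (add_le_add_left (measure_union_le _ _) _)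
    _ ≤ _ := by gcongr
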